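/- Let $n,p,d$ be natural numbers. A stream is a matrix $x\in\mathbb R^{n\times d}$ with rows $x_1,\dots,x_n$. Let $\mathbf N$ be any set of pairs $(x,\tilde x)$ of streams, called neighboring; for example, for a participation schema $\Pi$ (a set of subsets of $\{1,\dots,n\}$), the pairs that differ only in the norm-bounded contributions of one example to the steps of one $\pi\in\Pi$. Let $A\in\mathbb R^{n\times n}$ be lower triangular of full rank, and let $A=BC$ with $B\in\mathbb R^{n\times p}$, $C\in\mathbb R^{p\times n}$ be a factorization such that $\|C(x-\tilde x)\|_F\le\kappa$ for all $(x,\tilde x)\in\mathbf N$. Let $\sigma\in\mathbb R$, let $Z\in\mathbb R^{p\times d}$ have independent $\mathcal N(0,\kappa^2\sigma^2)$ entries, and let $\mathcal M(x)=Ax+BZ=B(Cx+Z)$. A privacy notion is one of the following relations between probability distributions $P,Q$: $(\varepsilon,\delta)$-DP with $\varepsilon,\delta\ge0$, that is, $P(S)\le e^{\varepsilon}Q(S)+\delta$ for all events $S$; $\rho$-zCDP with $\rho\ge0$, that is, $D_\alpha(P\|Q)\le\rho\alpha$ for all $\alpha>1$, where $D_\alpha$ is the Rényi divergence; $\mu$-Gaussian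 DP with $\mu\ge0$, that is, $T(P,Q)\ge T(\mathcal N(0,1),\mathcal N(\mu,1))$ on $[0,1]$, where $T(P,Q)(a)$ is the infimum of the type II errors of randomized tests of $P$ against $Q$ with type I error at most $a$. The mechanism satisfies a privacy notion in the nonadaptive continual release model if the laws of $\mathcal M(x)$ and $\mathcal M(\tilde x)$ are so related for all $(x,\tilde x)\in\mathbf N$. It satisfies it with adaptively chosen rows if the following holds for every adversary with private randomness $r$ (independent of $Z$): in each step $i$ the adversary chooses a pair of rows $(x_i,\tilde x_i)$ as a measurable function of $r$ and of the output rows released in steps $1,\dots,i-1$, such that $(x,\tilde x)\in\mathbf N$ for all values of $r$ and of the released rows; then the $i$-th row of $\mathcal M$ is released, where $\mathcal M$ receives $x_i$ in every step, or $\tilde x_i$ in every step; and the laws of $(r,\text{all released rows})$ in these two cases are so related. Then for each of the three privacy notions and for all values of its parameters: if $\mathcal M$ satisfies it in the nonadaptive continual release model, then $\mathcal M$ satisfies it, with the same parameters, when the rows of the input are chosen adaptively. -/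

import Mathlib

open MeasureTheory ProbabilityTheory
open scoped ENNReal NNReal

namespace ContinualRelease

noncomputable section

/-! ### Privacy notions for a pair of output distributions -/

/-- A way of saying that two probability distributions on a common measurable space are hard to
tell apart. A mechanism has the corresponding privacy guarantee when its output distributions on
all pairs of neighboring inputs are related in this way. -/
abbrev PrivacyNotion : Type 1 :=
  (Ω : Type) → [MeasurableSpace Ω] → Measure Ω → Measure Ω → Prop

/-- `(ε, δ)`-differential privacy: `P(S) ≤ e^ε Q(S) + δ` for all events `S`. -/
def approxDP (ε δ : ℝ≥0) : PrivacyNotion := fun _ _ P Q =>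
  ∀ S, MeasurableSet S → P S ≤ ENNReal.ofReal (Real.exp ε) * Q S + δ

open Classical in
/-- The Rényi divergence `D_α(P ‖ Q) = (α - 1)⁻¹ log ∫ (dP/dQ)^α dQ` of order `α > 1`, equal to
`∞` unless `P ≪ Q`. -/
def renyiDivergence {Ω : Type} [MeasurableSpace Ω] (α : ℝ) (P Q : Measure Ω) : EReal :=
  if P ≪ Q then (((α - 1)⁻¹ : ℝ) : EReal) * ENNReal.log (∫⁻ ω, (P.rnDeriv Q ω) ^ α ∂Q) else ⊤

/-- `ρ`-zero-concentrated differential privacy: `D_α(P ‖ Q) ≤ ρ α` for all `α > 1`. -/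
def zCDP (ρ : ℝ≥0) : PrivacyNotion := fun _ _ P Q =>
  ∀ α : ℝ, 1 < α → renyiDivergence α P Q ≤ ((ρ * α : ℝ) : EReal)

/-- The trade-off function `T(P, Q)`: the smallest type II error among (randomized) tests of
`P` against `Q` with type I error at most `a`. -/
def tradeoff {Ω : Type} [MeasurableSpace Ω] (P Q : Measure Ω) (a : ℝ) : ℝ :=
  sInf {b : ℝ | ∃ φ : Ω → ℝ, Measurable φ ∧ (∀ ω, φ ω ∈ Set.Icc (0 : ℝ) 1) ∧
    ∫ ω, φ ω ∂P ≤ a ∧ b = 1 - ∫ ω, φ ω ∂Q}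

/-- `μ`-Gaussian differential privacy: telling `P` from `Q` is at least as hard as telling
`N(0, 1)` from `N(μ, 1)`. -/
def gaussianDP (μ : ℝ≥0) : PrivacyNotion := fun _ _ P Q =>
  ∀ a ∈ Set.Icc (0 : ℝ) 1, tradeoff (gaussianReal 0 1) (gaussianReal μ 1) a ≤ tradeoff P Q a

/-! ### Streams and the Gaussian matrix mechanism -/

/-- A stream of `n` rows in `ℝ^d`. -/
abbrev DataStream (n d : ℕ) : Type := Matrix (Fin n) (Fin d) ℝ

/-- The product σ-algebra on matrices. -/
instance instMeasurableSpaceMatrix (m d : ℕ) : MeasurableSpace (Matrix (Fin m) (Fin d) ℝ) :=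
  inferInstanceAs (MeasurableSpace (Fin m → Fin d → ℝ))

open scoped Matrix.Norms.Frobenius in
/-- The Frobenius norm of a matrix. -/
def frobeniusNorm {m d : ℕ} (X : Matrix (Fin m) (Fin d) ℝ) : ℝ := ‖X‖

/-- The law of an `m × d` matrix with independent `N(0, v)` entries. -/
def gaussianMatrix (m d : ℕ) (v : ℝ≥0) : Measure (Matrix (Fin m) (Fin d) ℝ) :=
  (Measure.pi fun _ : Fin m => Measure.pi fun _ : Fin d => gaussianReal 0 v :
    Measure (Fin m → Fin d → ℝ))

/-- The output `B (C x + Z)` of the matrix mechanism on the stream `x` with noise `Z`. -/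
def matrixMechanism {n p d : ℕ} (B : Matrix (Fin n) (Fin p) ℝ) (C : Matrix (Fin p) (Fin n) ℝ)
    (Z : Matrix (Fin p) (Fin d) ℝ) (x : DataStream n d) : DataStream n d :=
  B * (C * x + Z)

/-! ### The nonadaptive and the adaptive continual release model

A mechanism is given by a noise space `W` with a distribution and a map `M` that sends a noise value
and an input stream to the output stream;
`N` is the set of pairs of neighboring streams, which may be any set of pairs: for instance those
that differ only in the contributions, bounded in norm, of one example to the steps of one
pattern of a participation schema. -/

/-- Nonadaptive model: the input stream is fixed in advance, and all rows of the output are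
released. -/
def NonadaptivelyPrivate (priv : PrivacyNotion) {n d : ℕ} (N : Set (DataStream n d × DataStream n d))
    {W : Type} [MeasurableSpace W] (noise : Measure W) (M : W → DataStream n d → DataStream n d) : Prop :=
  ∀ x x' : DataStream n d, (x, x') ∈ N →
    priv (DataStream n d) (noise.map fun z => M z x) (noise.map fun z => M z x')

/-- A rule for choosing the rows of a stream adaptively: the `i`-th row is a measurable function
of private randomness in `R` and of the output rows released before step `i`. -/
structure Strategy (n d : ℕ) (R : Type) [MeasurableSpace R] where
  /-- the row chosen at step `i` -/
  row : (i : Fin n) → R → ({j : Fin n // j < i} → Fin d → ℝ) → Fin d → ℝ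
  measurable_row : ∀ i, Measurable (Function.uncurry (row i))

/-- The stream that the rule chooses when the released rows are those of `y`. -/
def Strategy.stream {n d : ℕ} {R : Type} [MeasurableSpace R] (s : Strategy n d R) (r : R)
    (y : DataStream n d) : DataStream n d :=
  Matrix.of fun i => s.row i r fun j => y j

/-- The first `k` output rows of the interaction of the mechanism (with noise `z`) and the rule
`s` (with randomness `r`); the other rows are `0`. In step `k` the rule chooses the `k`-th input
row from the rows released so far, and the `k`-th output row of the mechanism on the stream so
far, with later input rows still `0`, is released. -/
def transcript {n d : ℕ} {R W : Type} [MeasurableSpace R] (M : W → DataStream n d → DataStream n d)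
    (s : Strategy n d R) (r : R) (z : W) : ℕ → DataStream n d
  | 0 => 0
  | k + 1 => Matrix.of fun i =>
      if (i : ℕ) = k then
        M z (Matrix.of fun j => if (j : ℕ) ≤ k then s.stream r (transcript M s r z k) j else 0) i
      else transcript M s r z k i

/-- What an adaptive adversary sees: the distribution of its own randomness together with all `n`
released rows, when the input rows are chosen by the rule `s`. -/
def viewLaw {n d : ℕ} {R W : Type} [MeasurableSpace R] [MeasurableSpace W] (seed : Measure R)
    (noise : Measure W) (M : W → DataStream n d → DataStream n d) (s : Strategy n d R) :
    Measure (R × DataStream n d) :=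
  (seed.prod noise).map fun q => (q.1, transcript M s q.1 q.2 n)

/-- Adaptive model: in each step an adversary, who may be randomized and sees all rows released
so far, chooses a pair of rows, given by rules `s` and `s'`, so that the resulting two streams are
neighboring whatever is released. The mechanism gets the row of `s` in every step, or that of
`s'` in every step, and these two cases have to be hard to tell apart for the adversary. -/
def AdaptivelyPrivate (priv : PrivacyNotion) {n d : ℕ} (N : Set (DataStream n d × DataStream n d))
    {W : Type} [MeasurableSpace W] (noise : Measure W) (M : W → DataStream n d → DataStream n d) : Prop :=
  ∀ (R : Type) [MeasurableSpace R] (seed : Measure R) [IsProbabilityMeasure seed]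
    (s s' : Strategy n d R), (∀ r y, (s.stream r y, s'.stream r y) ∈ N) →
    priv (R × DataStream n d) (viewLaw seed noise M s) (viewLaw seed noise M s')

end

end ContinualRelease

open ContinualRelease

namespace ContinualRelease

open Filter Topology

/-! ### Structural properties of the privacy notions -/

/-! Write `A = B * C` and choose `T` invertible and lower triangular such that `T * B` has
orthonormal rows (`exists_isLowerTriangular_whitening`). Whitened by `T`, the mechanism adds a
matrix `G` of independent Gaussians to `T * A * x`. For fixed neighbors, projecting to the line
through `T * A * x` and `T * A * x'` turns nonadaptive privacy into privacy of the pair `N(0, v)`,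
`N(m, v)` with `m` the Frobenius norm of `T * A * (x' - x)` (`priv_gaussianReal_of_priv_mechanism`).
A limit gives the same for the supremum `m` of these distances over `N`.

Conversely, that one-dimensional pair simulates every adaptive interaction (`exists_simulation`).
The whitened output solves `W = U (r, W) + G` with `U` strictly causal, because all matrices
involved are lower triangular, and the two choices of `U` are at distance at most `m`. Let `Y` have
law `N(b m, v)` with `b` equal to `0` or `1`, let `δ` be the difference of the two first rows of
`U`, and let `c² + |δ|² = m²`. A reflection taking `(m, 0)` to `(c, δ)` turns `Y` and a fresh
centered Gaussian row into independent Gaussians with means `b c` and `b δ`. The latter yields the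
first row of `W`; the former plays the role of `Y` for the remaining rows, whose distance is at most
`c`. The view is thus a randomized function of `Y` that does not involve `b`, and postprocessing
concludes.

If `v = 0` the outputs are point masses, and this case is treated separately. -/

/-- The properties of a privacy notion that the reduction from adaptive to nonadaptive streams
relies on: it is reflexive, stable under randomized postprocessing, closed under setwise limits in
the second argument, and only the trivial notion relates two distinct point masses. -/
structure PrivacyNotion.IsStable (priv : PrivacyNotion) : Prop where
  refl : ∀ {Ω : Type} [MeasurableSpace Ω] (P : Measure Ω) [IsProbabilityMeasure P], priv Ω P P
  map : ∀ {Ω Ω' : Type} [MeasurableSpace Ω] [MeasurableSpace Ω'] {P Q : Measure Ω}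
    [IsProbabilityMeasure P] [IsProbabilityMeasure Q] {f : Ω → Ω'}, Measurable f →
    priv Ω P Q → priv Ω' (P.map f) (Q.map f)
  prod : ∀ {Ω Ω' : Type} [MeasurableSpace Ω] [MeasurableSpace Ω'] {P Q : Measure Ω}
    [IsProbabilityMeasure P] [IsProbabilityMeasure Q] (ν : Measure Ω') [IsProbabilityMeasure ν],
    priv Ω P Q → priv (Ω × Ω') (P.prod ν) (Q.prod ν)
  of_tendsto : ∀ {Ω : Type} [MeasurableSpace Ω] {P Q : Measure Ω} {Qs : ℕ → Measure Ω}
    [IsProbabilityMeasure P] [IsProbabilityMeasure Q] [∀ k, IsProbabilityMeasure (Qs k)],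
    (∀ (h : Ω → ℝ≥0∞) (c : ℝ≥0), Measurable h → (∀ ω, h ω ≤ c) →
      Tendsto (fun k => ∫⁻ ω, h ω ∂Qs k) atTop (𝓝 (∫⁻ ω, h ω ∂Q))) →
    (∀ k, priv Ω P (Qs k)) → priv Ω P Q
  of_dirac : ∀ {Ω Ω' : Type} [MeasurableSpace Ω] [MeasurableSpace Ω'] {a b : Ω} {S : Set Ω},
    MeasurableSet S → a ∈ S → b ∉ S → priv Ω (Measure.dirac a) (Measure.dirac b) →
    ∀ (P Q : Measure Ω') [IsProbabilityMeasure P] [IsProbabilityMeasure Q], priv Ω' P Q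

/-- Products are handled fibre by fibre; `δ` survives because `ν` has mass one. Distinct point
masses force `δ ≥ 1`, which makes the notion vacuous. -/
lemma approxDP_isStable (ε δ : ℝ≥0) : (approxDP ε δ).IsStable where
  refl P _ S _ := by
    have h : (1 : ℝ≥0∞) ≤ ENNReal.ofReal (Real.exp ε) := by
      rw [← ENNReal.ofReal_one]
      exact ENNReal.ofReal_le_ofReal (Real.one_le_exp ε.2)
    calc P S = 1 * P S := (one_mul _).symm
      _ ≤ ENNReal.ofReal (Real.exp ε) * P S := by gcongr
      _ ≤ _ := le_self_add
  map hf h S hS := by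
    rw [Measure.map_apply hf hS, Measure.map_apply hf hS]
    exact h _ (hf hS)
  prod {Ω Ω' _ _ P Q _ _} ν _ h S hS := by
    rw [Measure.prod_apply_symm hS, Measure.prod_apply_symm hS]
    calc ∫⁻ y, P ((fun x => (x, y)) ⁻¹' S) ∂ν
        ≤ ∫⁻ y, (ENNReal.ofReal (Real.exp ε) * Q ((fun x => (x, y)) ⁻¹' S) + δ) ∂ν :=
          lintegral_mono fun y => h _ (measurable_prodMk_right hS)
      _ = _ := by
          rw [lintegral_add_right _ measurable_const,
            lintegral_const_mul _ (measurable_measure_prodMk_right hS)]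
          simp
  of_tendsto {Ω _ P Q Qs _ _ _} hlim h S hS := by
    have ht := hlim (S.indicator 1) 1 (measurable_one.indicator hS)
      (fun ω => by by_cases hω : ω ∈ S <;> simp [hω])
    simp only [lintegral_indicator_one hS] at ht
    have ht' : Tendsto (fun k => ENNReal.ofReal (Real.exp ε) * Qs k S + δ) atTop
        (𝓝 (ENNReal.ofReal (Real.exp ε) * Q S + δ)) :=
      (ENNReal.Tendsto.const_mul ht (Or.inr ENNReal.ofReal_ne_top)).add tendsto_const_nhds
    exact ge_of_tendsto' ht' fun k => h k S hS
  of_dirac {Ω Ω' _ _ a b S} hS ha hb h P Q _ _ T _ := by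
    have h1 := h S hS
    rw [Measure.dirac_apply' _ hS, Measure.dirac_apply' _ hS] at h1
    simp only [Set.indicator_of_mem ha, Set.indicator_of_notMem hb, Pi.one_apply, mul_zero,
      zero_add] at h1
    exact (prob_le_one.trans h1).trans le_add_self

/-! ### Zero-concentrated privacy through Hölder duality. -/

lemma coe_mul_le_coe_iff {c b : ℝ} (hc : 0 < c) (x : EReal) :
    (c⁻¹ : ℝ) * x ≤ (b : EReal) ↔ x ≤ ((b * c : ℝ) : EReal) := by
  induction x with
  | bot => simp [EReal.coe_mul_bot_of_pos (inv_pos.2 hc)]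
  | top => simp [EReal.coe_mul_top_of_pos (inv_pos.2 hc), -EReal.coe_mul]
  | coe x =>
    rw [← EReal.coe_mul, EReal.coe_le_coe_iff, EReal.coe_le_coe_iff, inv_mul_le_iff₀ hc, mul_comm]

lemma log_le_coe_iff (x : ℝ≥0∞) (b : ℝ) :
    ENNReal.log x ≤ (b : EReal) ↔ x ≤ ENNReal.ofReal (Real.exp b) := by
  have h : (b : EReal) = ENNReal.log (ENNReal.ofReal (Real.exp b)) := by
    rw [ENNReal.log_ofReal_of_pos (Real.exp_pos b), Real.log_exp]
  rw [h, ENNReal.log_le_log_iff]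

/-- The bound `exp (ρ α (α - 1))` is written as an `α`-th power so that an `α`-th root gives a bound
on the `L^α` norm of the density. -/
lemma zCDP_iff {ρ : ℝ≥0} {Ω : Type} [MeasurableSpace Ω] {P Q : Measure Ω} :
    zCDP ρ Ω P Q ↔ ∀ α : ℝ, 1 < α → P ≪ Q ∧
      ∫⁻ ω, (P.rnDeriv Q ω) ^ α ∂Q ≤ ENNReal.ofReal (Real.exp (ρ * (α - 1))) ^ α := by
  refine forall₂_congr fun α hα => ?_
  unfold renyiDivergence
  split_ifs with h
  · rw [coe_mul_le_coe_iff (sub_pos.2 hα), log_le_coe_iff,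
      ENNReal.ofReal_rpow_of_pos (Real.exp_pos _), ← Real.exp_mul]
    simp only [h, true_and]
    ring_nf
  · simp [h, -EReal.coe_mul]

/-- Dual description of zero-concentrated differential privacy. -/
lemma zCDP_iff_lintegral_le {ρ : ℝ≥0} {Ω : Type} [MeasurableSpace Ω] {P Q : Measure Ω}
    [IsProbabilityMeasure P] [IsProbabilityMeasure Q] :
    zCDP ρ Ω P Q ↔ ∀ α q : ℝ, α.HolderConjugate q → ∀ (h : Ω → ℝ≥0∞) (c : ℝ≥0), Measurable h →
      (∀ ω, h ω ≤ c) → ∫⁻ ω, h ω ∂P ≤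
        ENNReal.ofReal (Real.exp (ρ * (α - 1))) * (∫⁻ ω, h ω ^ q ∂Q) ^ (1 / q) := by
  rw [zCDP_iff]
  constructor
  · intro H α q hq h c hh _
    obtain ⟨hPQ, hI⟩ := H α hq.lt
    rw [← lintegral_rnDeriv_mul hPQ hh.aemeasurable]
    refine (ENNReal.lintegral_mul_le_Lp_mul_Lq Q hq (Measure.measurable_rnDeriv P Q).aemeasurable
      hh.aemeasurable).trans ?_
    gcongr
    rw [one_div]
    exact (ENNReal.rpow_inv_le_iff hq.pos).2 hI
  · intro H α hα
    have hq := Real.HolderConjugate.conjExponent hα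
    set q := α.conjExponent
    set K := ENNReal.ofReal (Real.exp (ρ * (α - 1)))
    have hPQ : P ≪ Q := by
      refine Measure.AbsolutelyContinuous.mk fun S hS hQS => ?_
      have h1 := H α q hq (S.indicator 1) 1 (measurable_one.indicator hS)
        (fun ω => by by_cases hω : ω ∈ S <;> simp [hω])
      have h2 : (fun ω => (S.indicator (1 : Ω → ℝ≥0∞) ω) ^ q) = S.indicator 1 := by
        ext ω
        by_cases hω : ω ∈ S <;> simp [hω, hq.symm.pos]
      rw [h2, lintegral_indicator_one hS, lintegral_indicator_one hS, hQS,
        ENNReal.zero_rpow_of_pos (by have := hq.symm.pos; positivity), mul_zero] at h1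
      exact le_antisymm h1 bot_le
    refine ⟨hPQ, ?_⟩
    set p := P.rnDeriv Q
    have hpm : Measurable p := Measure.measurable_rnDeriv P Q
    -- Truncation keeps the test function bounded and `J` finite, so that a power of `J` can be
    -- cancelled below.
    have hJ : ∀ k : ℕ, ∫⁻ ω, (min (p ω) k) ^ α ∂Q ≤ K ^ α := by
      intro k
      have hmk : Measurable fun ω => min (p ω) (k : ℝ≥0∞) := hpm.min measurable_const
      set J := ∫⁻ ω, (min (p ω) k) ^ α ∂Q
      have hJtop : J ≠ ∞ := by
        refine ne_top_of_le_ne_top (b := (k : ℝ≥0∞) ^ α) (by simp [hq.pos.le]) ?_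
        calc J ≤ ∫⁻ _, (k : ℝ≥0∞) ^ α ∂Q :=
              lintegral_mono fun ω => ENNReal.rpow_le_rpow (min_le_right _ _) hq.pos.le
          _ = _ := by simp
      have h1 : J ≤ K * J ^ (1 / q) := by
        -- The power `α - 1` is the equality case of Hölder, since `(α - 1) q = α`.
        have h2 := H α q hq (fun ω => (min (p ω) k) ^ (α - 1)) ((k : ℝ≥0) ^ (α - 1))
          (hmk.pow_const _) (fun ω => by
            rw [ENNReal.coe_rpow_of_nonneg _ (by linarith)]
            exact ENNReal.rpow_le_rpow (by simp) (by linarith))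
        have h3 : (α - 1) * q = α := by
          have := hq.sub_one_mul_conj; simpa using this
        simp only [← ENNReal.rpow_mul, h3] at h2
        refine le_trans ?_ h2
        rw [← lintegral_rnDeriv_mul hPQ (hmk.pow_const _).aemeasurable]
        refine lintegral_mono fun ω => ?_
        have h4 : (min (p ω) (k : ℝ≥0∞)) ^ α
            = min (p ω) (k : ℝ≥0∞) * min (p ω) (k : ℝ≥0∞) ^ (α - 1) := by
          conv_rhs => rw [← ENNReal.rpow_one (min (p ω) (k : ℝ≥0∞)), ← ENNReal.rpow_mul, one_mul]
          rw [← ENNReal.rpow_add_of_nonneg _ _ zero_le_one (by linarith)]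
          congr 1; ring
        simp only [h4]
        gcongr
        exact min_le_left _ _
      by_cases hJ0 : J = 0
      · rw [hJ0]; exact bot_le
      have h5 : J ^ (1 / α) ≤ K := by
        have h6 : J = J ^ (1 / α) * J ^ (1 / q) := by
          rw [← ENNReal.rpow_add _ _ hJ0 hJtop]
          have := hq.inv_add_inv_eq_one
          simp [this]
        have h7 : J ^ (1 / q) ≠ 0 := by
          simp [ENNReal.rpow_eq_zero_iff, hJ0, hJtop]
        have h8 : J ^ (1 / q) ≠ ∞ := by
          simp [ENNReal.rpow_eq_top_iff, hJ0, hJtop]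
        have h9 : J ^ (1 / α) * J ^ (1 / q) ≤ K * J ^ (1 / q) := h6.symm.le.trans h1
        exact (ENNReal.mul_le_mul_iff_left h7 h8).1 h9
      rw [one_div] at h5
      exact (ENNReal.rpow_inv_le_iff hq.pos).1 h5
    have hlim : Tendsto (fun k : ℕ => ∫⁻ ω, (min (p ω) k) ^ α ∂Q) atTop
        (𝓝 (∫⁻ ω, p ω ^ α ∂Q)) := by
      refine lintegral_tendsto_of_tendsto_of_monotone
        (fun k => ((hpm.min measurable_const).pow_const _).aemeasurable) ?_ ?_
      · refine ae_of_all _ fun ω k l hkl => ENNReal.rpow_le_rpow ?_ hq.pos.le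
        exact min_le_min_left _ (by exact_mod_cast hkl)
      · refine ae_of_all _ fun ω => ?_
        refine (ENNReal.continuous_rpow_const.tendsto _).comp ?_
        have h := (tendsto_const_nhds (x := p ω)).min ENNReal.tendsto_nat_nhds_top
        simpa using h
    exact le_of_tendsto' hlim hJ

/-- Jensen for the concave power `1 / q`, as Hölder against the constant `1`. It merges the
fibrewise bounds in a product. -/
lemma lintegral_rpow_one_div_le {Ω : Type*} [MeasurableSpace Ω] (ν : Measure Ω)
    [IsProbabilityMeasure ν] {α q : ℝ} (hq : α.HolderConjugate q) {f : Ω → ℝ≥0∞}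
    (hf : Measurable f) : ∫⁻ w, f w ^ (1 / q) ∂ν ≤ (∫⁻ w, f w ∂ν) ^ (1 / q) := by
  have h := ENNReal.lintegral_mul_le_Lp_mul_Lq ν hq (f := 1) (g := fun w => f w ^ (1 / q))
    aemeasurable_const (hf.pow_const _).aemeasurable
  simpa [← ENNReal.rpow_mul, hq.symm.ne_zero] using h

/-- In the dual form only integrals of bounded functions occur, so maps, products and limits pass
through. Distinct point masses violate absolute continuity. -/
lemma zCDP_isStable (ρ : ℝ≥0) : (zCDP ρ).IsStable where
  refl P _ := by
    rw [zCDP_iff]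
    refine fun α hα => ⟨Measure.AbsolutelyContinuous.rfl, ?_⟩
    rw [lintegral_congr_ae (g := fun _ => 1)]
    · rw [lintegral_one, measure_univ]
      refine ENNReal.one_le_rpow ?_ (by linarith)
      rw [← ENNReal.ofReal_one]
      exact ENNReal.ofReal_le_ofReal (Real.one_le_exp (mul_nonneg ρ.2 (by linarith)))
    · filter_upwards [Measure.rnDeriv_self P] with ω hω
      simp [hω]
  map {Ω Ω' _ _ P Q _ _ f} hf h := by
    have := Measure.isProbabilityMeasure_map (μ := P) hf.aemeasurable
    have := Measure.isProbabilityMeasure_map (μ := Q) hf.aemeasurable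
    rw [zCDP_iff_lintegral_le] at h ⊢
    intro α q hq g c hg hc
    rw [lintegral_map hg hf, lintegral_map (hg.pow_const _) hf]
    exact h α q hq (fun ω => g (f ω)) c (hg.comp hf) fun ω => hc _
  prod {Ω Ω' _ _ P Q _ _} ν _ h := by
    rw [zCDP_iff_lintegral_le] at h ⊢
    intro α q hq g c hg hc
    have hgq : Measurable fun z => g z ^ q := hg.pow_const _
    rw [lintegral_prod_symm _ hg.aemeasurable, lintegral_prod_symm _ hgq.aemeasurable]
    calc ∫⁻ y, ∫⁻ x, g (x, y) ∂P ∂ν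
        ≤ ∫⁻ y, ENNReal.ofReal (Real.exp (ρ * (α - 1))) *
            (∫⁻ x, g (x, y) ^ q ∂Q) ^ (1 / q) ∂ν :=
          lintegral_mono fun y => h α q hq (fun x => g (x, y)) c
            (hg.comp measurable_prodMk_right) fun _ => hc _
      _ = ENNReal.ofReal (Real.exp (ρ * (α - 1))) *
            ∫⁻ y, (∫⁻ x, g (x, y) ^ q ∂Q) ^ (1 / q) ∂ν :=
          lintegral_const_mul _ (hgq.lintegral_prod_left'.pow_const _)
      _ ≤ _ := by
          gcongr
          exact lintegral_rpow_one_div_le ν hq hgq.lintegral_prod_left'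
  of_tendsto {Ω _ P Q Qs _ _ _} hlim h := by
    rw [zCDP_iff_lintegral_le]
    intro α q hq g c hg hc
    have h' := fun k => zCDP_iff_lintegral_le.1 (h k) α q hq g c hg hc
    have ht := hlim (fun ω => g ω ^ q) (c ^ q) (hg.pow_const _) fun ω => by
      rw [ENNReal.coe_rpow_of_nonneg _ hq.symm.pos.le]
      exact ENNReal.rpow_le_rpow (hc ω) hq.symm.pos.le
    have ht' := ENNReal.Tendsto.const_mul (a := ENNReal.ofReal (Real.exp (ρ * (α - 1))))
      ((ENNReal.continuous_rpow_const (y := 1 / q)).tendsto _ |>.comp ht)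
      (Or.inr ENNReal.ofReal_ne_top)
    exact ge_of_tendsto' ht' h'
  of_dirac {Ω Ω' _ _ a b S} hS ha hb h P Q _ _ := by
    have hac := ((zCDP_iff.1 h) 2 one_lt_two).1
    have h1 : Measure.dirac b S = 0 := by simp [Measure.dirac_apply' _ hS, hb]
    have h2 := hac h1
    simp [Measure.dirac_apply' _ hS, ha] at h2

/-! ### Gaussian privacy and trade-off functions. -/

lemma integral_mem_Icc {Ω : Type*} [MeasurableSpace Ω] (Q : Measure Ω) [IsProbabilityMeasure Q]
    {φ : Ω → ℝ} (hφ : ∀ ω, φ ω ∈ Set.Icc (0 : ℝ) 1) : ∫ ω, φ ω ∂Q ∈ Set.Icc (0 : ℝ) 1 := by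
  refine ⟨integral_nonneg fun ω => (hφ ω).1, ?_⟩
  have h := integral_mono_of_nonneg (μ := Q) (ae_of_all _ fun ω => (hφ ω).1)
    (integrable_const (1 : ℝ)) (ae_of_all _ fun ω => (hφ ω).2)
  simpa using h

lemma tradeoff_le {Ω : Type} [MeasurableSpace Ω] {P Q : Measure Ω} [IsProbabilityMeasure Q]
    {a : ℝ} {φ : Ω → ℝ} (hm : Measurable φ) (hφ : ∀ ω, φ ω ∈ Set.Icc (0 : ℝ) 1)
    (ha : ∫ ω, φ ω ∂P ≤ a) : tradeoff P Q a ≤ 1 - ∫ ω, φ ω ∂Q := by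
  refine csInf_le ⟨0, ?_⟩ ⟨φ, hm, hφ, ha, rfl⟩
  rintro b ⟨ψ, -, hψ, -, rfl⟩
  exact sub_nonneg.2 (integral_mem_Icc Q hψ).2

lemma le_tradeoff_iff {Ω : Type} [MeasurableSpace Ω] {P Q : Measure Ω} [IsProbabilityMeasure Q]
    {a t : ℝ} (ha : 0 ≤ a) : t ≤ tradeoff P Q a ↔
      ∀ φ : Ω → ℝ, Measurable φ → (∀ ω, φ ω ∈ Set.Icc (0 : ℝ) 1) → ∫ ω, φ ω ∂P ≤ a →
        t ≤ 1 - ∫ ω, φ ω ∂Q := by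
  constructor
  · exact fun h φ hm hφ hφa => h.trans (tradeoff_le hm hφ hφa)
  · intro h
    -- The zero test makes the set nonempty, which excludes the default value of `sInf`.
    refine le_csInf ⟨1, 0, measurable_zero, by simp, by simpa using ha, by simp⟩ ?_
    rintro b ⟨ψ, hm, hψ, hψa, rfl⟩
    exact h ψ hm hψ hψa

/-- A test without type I error vanishes almost everywhere under one Gaussian, hence under the
other. This rules out distinct point masses in `gaussianDP_isStable`. -/
lemma tradeoff_gaussianReal_zero (μ : ℝ) :
    1 ≤ tradeoff (gaussianReal 0 1) (gaussianReal μ 1) 0 := by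
  rw [le_tradeoff_iff le_rfl]
  intro φ hm hφ h0
  have hint : Integrable φ (gaussianReal 0 1) :=
    Integrable.of_bound hm.aestronglyMeasurable 1 (ae_of_all _ fun ω => by
      rw [Real.norm_of_nonneg (hφ ω).1]; exact (hφ ω).2)
  have h1 : φ =ᵐ[gaussianReal 0 1] 0 :=
    (integral_eq_zero_iff_of_nonneg (fun ω => (hφ ω).1) hint).1
      (le_antisymm h0 (integral_mem_Icc _ hφ).1)
  have hac : gaussianReal μ 1 ≪ gaussianReal 0 1 :=
    (gaussianReal_absolutelyContinuous μ one_ne_zero).trans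
      (gaussianReal_absolutelyContinuous' 0 one_ne_zero)
  rw [integral_congr_ae (hac.ae_eq h1)]
  simp

lemma integral_eq_toReal_lintegral {Ω : Type*} [MeasurableSpace Ω] (Q : Measure Ω) {φ : Ω → ℝ}
    (hm : Measurable φ) (hφ : ∀ ω, φ ω ∈ Set.Icc (0 : ℝ) 1) :
    ∫ ω, φ ω ∂Q = (∫⁻ ω, ENNReal.ofReal (φ ω) ∂Q).toReal :=
  integral_eq_lintegral_of_nonneg_ae (ae_of_all _ fun ω => (hφ ω).1) hm.aestronglyMeasurable

lemma gaussianDP_isStable (μ : ℝ≥0) : (gaussianDP μ).IsStable where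
  refl P _ a ha := by
    rw [le_tradeoff_iff ha.1]
    intro φ _ _ h
    -- The constant test `a` bounds the Gaussian trade-off by `1 - a`, which no test of `P` against
    -- itself can beat.
    have h1 := tradeoff_le (P := gaussianReal 0 1) (Q := gaussianReal μ 1) (a := a)
      (φ := fun _ => a) measurable_const (fun _ => ha) (by simp)
    simp only [integral_const, probReal_univ, one_smul] at h1
    linarith
  map {Ω Ω' _ _ P Q _ _ f} hf h a ha := by
    have := Measure.isProbabilityMeasure_map (μ := Q) hf.aemeasurable
    rw [le_tradeoff_iff ha.1]
    intro φ hm hφ hφa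
    rw [integral_map hf.aemeasurable hm.aestronglyMeasurable] at hφa ⊢
    exact (le_tradeoff_iff ha.1).1 (h a ha) _ (hm.comp hf) (fun ω => hφ _) hφa
  prod {Ω Ω' _ _ P Q _ _} ν _ h a ha := by
    rw [le_tradeoff_iff ha.1]
    intro φ hm hφ hφa
    have hint : ∀ Q : Measure Ω, IsProbabilityMeasure Q → Integrable φ (Q.prod ν) := fun Q _ =>
      Integrable.of_bound hm.aestronglyMeasurable 1 (ae_of_all _ fun ω => by
        rw [Real.norm_of_nonneg (hφ ω).1]; exact (hφ ω).2)
    rw [integral_prod _ (hint _ inferInstance)] at hφa ⊢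
    -- Averaging a test over the independent noise gives a test on the first factor.
    exact (le_tradeoff_iff ha.1).1 (h a ha) (fun x => ∫ y, φ (x, y) ∂ν)
      hm.stronglyMeasurable.integral_prod_right'.measurable
      (fun x => integral_mem_Icc ν fun y => hφ _) hφa
  of_tendsto {Ω _ P Q Qs _ _ _} hlim h a ha := by
    rw [le_tradeoff_iff ha.1]
    intro φ hm hφ hφa
    have ht := hlim (fun ω => ENNReal.ofReal (φ ω)) 1 hm.ennreal_ofReal fun ω => by
      simpa using (hφ ω).2
    have hfin : ∫⁻ ω, ENNReal.ofReal (φ ω) ∂Q ≠ ∞ := by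
      refine ne_top_of_le_ne_top ENNReal.one_ne_top ?_
      calc ∫⁻ ω, ENNReal.ofReal (φ ω) ∂Q ≤ ∫⁻ _, 1 ∂Q :=
            lintegral_mono fun ω => by simpa using (hφ ω).2
        _ = 1 := by simp
    have ht' := (ENNReal.tendsto_toReal hfin).comp ht
    simp only [Function.comp_def, ← integral_eq_toReal_lintegral _ hm hφ] at ht'
    exact ge_of_tendsto' (tendsto_const_nhds.sub ht') fun k =>
      (le_tradeoff_iff ha.1).1 (h k a ha) φ hm hφ hφa
  of_dirac {Ω Ω' _ _ a b S} hS ha hb h P Q _ _ := by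
    have h1 := (tradeoff_gaussianReal_zero μ).trans (h 0 (by simp))
    have hm : Measurable (Sᶜ.indicator (1 : Ω → ℝ)) := measurable_one.indicator hS.compl
    have h2 := tradeoff_le (P := Measure.dirac a) (Q := Measure.dirac b) (a := 0) hm
      (fun ω => by by_cases hω : ω ∈ S <;> simp [hω])
      (by rw [integral_dirac' _ _ hm.stronglyMeasurable]; simp [ha])
    rw [integral_dirac' _ _ hm.stronglyMeasurable] at h2
    simp [hb] at h2
    linarith

open Matrix

/-! ### Gaussian vectors and matrices -/

/-- A matrix with orthonormal rows maps a vector of independent centered Gaussians of the same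
variance to such a vector. -/
lemma map_mulVec_pi_gaussianReal {ι κ : Type*} [Fintype ι] [Fintype κ] [DecidableEq κ] (v : ℝ≥0)
    (U : Matrix κ ι ℝ) (hU : U * Uᵀ = 1) :
    (Measure.pi fun _ : ι => gaussianReal 0 v).map (fun x => U *ᵥ x) =
      Measure.pi fun _ : κ => gaussianReal 0 v := by
  have hUm : Measurable fun x : ι → ℝ => U *ᵥ x := by
    refine measurable_pi_lambda _ fun i => ?_
    simp only [Matrix.mulVec, dotProduct]
    fun_prop
  have := Measure.isProbabilityMeasure_map (μ := Measure.pi fun _ : ι => gaussianReal 0 v)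
    hUm.aemeasurable
  apply (MeasurableEquiv.toLp 2 (κ → ℝ)).map_measurableEquiv_injective
  change Measure.map (WithLp.toLp 2) _ = Measure.map (WithLp.toLp 2) _
  -- The Gaussian characteristic function depends only on the norm of its argument, and `Uᵀ` is an
  -- isometry.
  apply Measure.ext_of_charFun (E := EuclideanSpace ℝ κ)
  ext t
  have h1 : charFun (((Measure.pi fun _ : ι => gaussianReal 0 v).map (fun x => U *ᵥ x)).map
      (WithLp.toLp 2)) t = charFun ((Measure.pi fun _ : ι => gaussianReal 0 v).map (WithLp.toLp 2))
        (WithLp.toLp 2 (Uᵀ *ᵥ t.ofLp) : EuclideanSpace ℝ ι) := by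
    rw [charFun_apply, charFun_apply, integral_map (by fun_prop) (by fun_prop),
      integral_map hUm.aemeasurable (by fun_prop), integral_map (by fun_prop) (by fun_prop)]
    refine integral_congr_ae (ae_of_all _ fun x => ?_)
    have : inner ℝ (WithLp.toLp 2 (U *ᵥ x) : EuclideanSpace ℝ κ) t =
        inner ℝ (WithLp.toLp 2 x : EuclideanSpace ℝ ι) (WithLp.toLp 2 (Uᵀ *ᵥ t.ofLp)) := by
      simp only [EuclideanSpace.inner_eq_star_dotProduct, star_trivial]
      rw [Matrix.dotProduct_mulVec, Matrix.mulVec_transpose, dotProduct_comm]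
    simp only [this]
  have h2 : ∑ i, (Uᵀ *ᵥ t.ofLp) i ^ 2 = ∑ k, t.ofLp k ^ 2 := by
    have : (Uᵀ *ᵥ t.ofLp) ⬝ᵥ (Uᵀ *ᵥ t.ofLp) = t.ofLp ⬝ᵥ t.ofLp := by
      rw [Matrix.dotProduct_mulVec, Matrix.vecMul_transpose, Matrix.mulVec_mulVec, hU,
        Matrix.one_mulVec]
    simpa [dotProduct, sq] using this
  rw [h1, charFun_pi, charFun_pi]
  simp only [charFun_gaussianReal, ← Complex.exp_sum]
  congr 1
  simp only [Complex.ofReal_zero, mul_zero, zero_mul, zero_sub, Finset.sum_neg_distrib,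
    ← Finset.sum_div, ← Finset.mul_sum, ← Complex.ofReal_pow, ← Complex.ofReal_sum, h2]

instance isProbabilityMeasure_gaussianMatrix (m d : ℕ) (v : ℝ≥0) :
    IsProbabilityMeasure (gaussianMatrix m d v) :=
  inferInstanceAs (IsProbabilityMeasure
    (Measure.pi fun _ : Fin m => Measure.pi fun _ : Fin d => gaussianReal 0 v))

lemma map_curry_pi_gaussianReal (m d : ℕ) (v : ℝ≥0) :
    (Measure.pi fun _ : Fin m × Fin d => gaussianReal 0 v).map
      (fun x => (Matrix.of fun i j => x (i, j) : Matrix (Fin m) (Fin d) ℝ)) =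
      gaussianMatrix m d v := by
  have h := Measure.infinitePi_map_curry (ι := Fin m) (κ := Fin d) fun _ _ => gaussianReal 0 v
  simp only [Measure.infinitePi_eq_pi] at h
  exact h

lemma measurable_of_curry (m d : ℕ) : Measurable fun x : Fin m × Fin d → ℝ =>
    (Matrix.of fun i j => x (i, j) : Matrix (Fin m) (Fin d) ℝ) :=
  (MeasurableEquiv.curry (Fin m) (Fin d) ℝ).measurable

lemma measurable_matrix {Ω : Type*} [MeasurableSpace Ω] {m d : ℕ}
    {f : Ω → Matrix (Fin m) (Fin d) ℝ} (hf : ∀ i j, Measurable fun ω => f ω i j) : Measurable f :=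
  measurable_pi_lambda _ fun i => measurable_pi_lambda _ fun j => hf i j

lemma measurable_entry {m d : ℕ} (i : Fin m) (j : Fin d) :
    Measurable fun X : Matrix (Fin m) (Fin d) ℝ => X i j :=
  (measurable_pi_apply j).comp (measurable_pi_apply (X := fun _ : Fin m => Fin d → ℝ) i)

lemma measurable_const_mul_matrix {l m d : ℕ} (Q : Matrix (Fin l) (Fin m) ℝ) :
    Measurable fun X : Matrix (Fin m) (Fin d) ℝ => Q * X := by
  refine measurable_matrix fun i j => ?_
  simp only [Matrix.mul_apply]
  exact Finset.measurable_fun_sum _ fun k _ => (measurable_entry k j).const_mul _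

lemma measurable_add_matrix {Ω : Type*} [MeasurableSpace Ω] {m d : ℕ}
    {f g : Ω → Matrix (Fin m) (Fin d) ℝ} (hf : Measurable f) (hg : Measurable g) :
    Measurable fun ω => f ω + g ω :=
  measurable_matrix fun i j =>
    ((measurable_entry i j).comp hf).add ((measurable_entry i j).comp hg)

open scoped Kronecker in
-- On flattened matrices, left multiplication by `Q` is `Q ⊗ₖ 1`, which again has orthonormal rows.
lemma map_mul_gaussianMatrix {n p : ℕ} (d : ℕ) (v : ℝ≥0) (Q : Matrix (Fin n) (Fin p) ℝ)
    (hQ : Q * Qᵀ = 1) :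
    (gaussianMatrix p d v).map (fun Z => Q * Z) = gaussianMatrix n d v := by
  have hU : (Q ⊗ₖ (1 : Matrix (Fin d) (Fin d) ℝ)) * (Q ⊗ₖ (1 : Matrix (Fin d) (Fin d) ℝ))ᵀ = 1 := by
    rw [← Matrix.kroneckerMap_transpose, ← Matrix.mul_kronecker_mul, hQ, Matrix.transpose_one,
      Matrix.mul_one, Matrix.one_kronecker_one]
  have hUm : Measurable fun x : Fin p × Fin d → ℝ =>
      (Q ⊗ₖ (1 : Matrix (Fin d) (Fin d) ℝ)) *ᵥ x := by
    refine measurable_pi_lambda _ fun i => ?_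
    simp only [Matrix.mulVec, dotProduct]
    fun_prop
  rw [← map_curry_pi_gaussianReal, ← map_curry_pi_gaussianReal, ← map_mulVec_pi_gaussianReal v _ hU,
    Measure.map_map (measurable_const_mul_matrix Q) (measurable_of_curry p d),
    Measure.map_map (measurable_of_curry n d) hUm]
  congr 1
  ext x i j
  simp [Matrix.mul_apply, Matrix.mulVec, dotProduct, Fintype.sum_prod_type, Matrix.one_apply]

lemma map_sum_mul_gaussianMatrix {n d : ℕ} (v : ℝ≥0) (θ : Matrix (Fin n) (Fin d) ℝ)
    (hθ : ∑ i, ∑ j, θ i j ^ 2 = 1) :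
    (gaussianMatrix n d v).map (fun G => ∑ i, ∑ j, θ i j * G i j) = gaussianReal 0 v := by
  set U : Matrix Unit (Fin n × Fin d) ℝ := Matrix.of fun _ ij => θ ij.1 ij.2
  have hU : U * Uᵀ = 1 := by
    ext i j
    simp [U, Matrix.mul_apply, Fintype.sum_prod_type, ← sq, hθ]
  have hUm : Measurable fun x : Fin n × Fin d → ℝ => U *ᵥ x := by
    refine measurable_pi_lambda _ fun i => ?_
    simp only [Matrix.mulVec, dotProduct]
    fun_prop
  have hm : Measurable fun G : Matrix (Fin n) (Fin d) ℝ => ∑ i, ∑ j, θ i j * G i j :=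
    Finset.measurable_fun_sum _ fun i _ => Finset.measurable_fun_sum _ fun j _ =>
      (measurable_entry i j).const_mul _
  have h := (measurePreserving_funUnique (gaussianReal 0 v) Unit).map_eq
  rw [← map_mulVec_pi_gaussianReal v U hU, Measure.map_map (MeasurableEquiv.measurable _) hUm] at h
  rw [← map_curry_pi_gaussianReal, Measure.map_map hm (measurable_of_curry n d)]
  refine Eq.trans ?_ h
  congr 1
  ext x
  simp [U, Matrix.mulVec, dotProduct, Fintype.sum_prod_type]

lemma gaussianMatrix_zero_var (m d : ℕ) : gaussianMatrix m d 0 = Measure.dirac 0 := by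
  have h : ∀ {ι : Type} [Fintype ι] {X : Type} [MeasurableSpace X] (a : X),
      (Measure.pi fun _ : ι => Measure.dirac a) = Measure.dirac fun _ => a := by
    intro ι _ X _ a
    have (i : ι) : SigmaFinite ((fun _ : ι => Measure.dirac a) i) := inferInstance
    refine Measure.pi_eq fun s hs => ?_
    rw [Measure.dirac_apply' _ (MeasurableSet.univ_pi hs)]
    simp only [Measure.dirac_apply' _ (hs _)]
    by_cases hi : ∀ i, a ∈ s i
    · rw [Set.indicator_of_mem (Set.mem_univ_pi.2 hi)]
      simp [hi]
    · rw [Set.indicator_of_notMem (by simpa [Set.mem_univ_pi] using hi)]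
      push Not at hi
      obtain ⟨i, hi⟩ := hi
      exact (Finset.prod_eq_zero (Finset.mem_univ i) (by simp [hi])).symm
  unfold gaussianMatrix
  simp only [gaussianReal_zero_var, h]
  rfl

/-! ### Reflections that trade a scalar shift for a vector shift. -/

/-- The orthogonal reflection of `ℝ × ℝ^d` that exchanges `(c, 0)` and `(c', δ)`, which are
assumed to have the same Euclidean norm. -/
noncomputable def reflect {d : ℕ} (c c' : ℝ) (δ : Fin d → ℝ) (q : ℝ × (Fin d → ℝ)) :
    ℝ × (Fin d → ℝ) :=
  let k := 2 / ((c - c') ^ 2 + ∑ j, δ j ^ 2) * (q.1 * (c - c') - ∑ j, q.2 j * δ j)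
  (q.1 - k * (c - c'), fun j => q.2 j + k * δ j)

lemma measurable_reflect {Ω : Type*} [MeasurableSpace Ω] {d : ℕ} {c c' : Ω → ℝ}
    {δ : Ω → Fin d → ℝ} {q : Ω → ℝ × (Fin d → ℝ)} (hc : Measurable c) (hc' : Measurable c')
    (hδ : Measurable δ) (hq : Measurable q) :
    Measurable fun ω => reflect (c ω) (c' ω) (δ ω) (q ω) := by
  unfold reflect
  fun_prop

/-- Orthogonality of the Householder reflection in `w`; for `w = 0` the convention `2 / 0 = 0` makes
it the identity. -/
lemma one_sub_smul_vecMulVec_mul_transpose {ι : Type*} [Fintype ι] [DecidableEq ι] (w : ι → ℝ) :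
    (1 - (2 / (w ⬝ᵥ w)) • vecMulVec w w) * (1 - (2 / (w ⬝ᵥ w)) • vecMulVec w w)ᵀ = 1 := by
  have ht : (1 - (2 / (w ⬝ᵥ w)) • vecMulVec w w)ᵀ = 1 - (2 / (w ⬝ᵥ w)) • vecMulVec w w := by
    ext i j
    simp [vecMulVec_apply, Matrix.one_apply, eq_comm, mul_comm (w i)]
  rw [ht]
  by_cases h : w ⬝ᵥ w = 0
  · simp [h]
  · have h1 : vecMulVec w w * vecMulVec w w = (w ⬝ᵥ w) • vecMulVec w w := by
      rw [vecMulVec_mul_vecMulVec]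
      ext i j
      simp [vecMulVec_apply]
      ring
    rw [sub_mul, mul_sub, mul_sub, one_mul, mul_one, one_mul, smul_mul_smul_comm, h1, smul_smul]
    have h2 : 2 / (w ⬝ᵥ w) * (2 / (w ⬝ᵥ w)) * (w ⬝ᵥ w) = 2 * (2 / (w ⬝ᵥ w)) := by
      field_simp
    rw [h2, mul_smul, two_smul]
    abel

lemma map_reflect_gaussian (d : ℕ) (v : ℝ≥0) (c c' : ℝ) (δ : Fin d → ℝ) :
    ((gaussianReal 0 v).prod (Measure.pi fun _ : Fin d => gaussianReal 0 v)).map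
      (reflect c c' δ) =
      (gaussianReal 0 v).prod (Measure.pi fun _ : Fin d => gaussianReal 0 v) := by
  have he := measurePreserving_piFinSuccAbove (fun _ : Fin (d + 1) => gaussianReal 0 v) 0
  -- The difference `(c, 0) - (c', δ)` of the exchanged vectors: `reflect` is the Householder
  -- reflection in `w`.
  set w : Fin (d + 1) → ℝ := Fin.cons (c - c') (-δ) with hw
  have hH := map_mulVec_pi_gaussianReal v _ (one_sub_smul_vecMulVec_mul_transpose w)
  set H : Matrix (Fin (d + 1)) (Fin (d + 1)) ℝ := 1 - (2 / (w ⬝ᵥ w)) • vecMulVec w w with hHdef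
  have hHm : Measurable fun x : Fin (d + 1) → ℝ => H *ᵥ x := by
    refine measurable_pi_lambda _ fun i => ?_
    simp only [Matrix.mulVec, dotProduct]
    fun_prop
  have hr : Measurable (reflect c c' δ) :=
    measurable_reflect measurable_const measurable_const measurable_const measurable_id
  rw [← he.map_eq, Measure.map_map hr (MeasurableEquiv.measurable _)]
  conv_rhs => rw [← hH, Measure.map_map (MeasurableEquiv.measurable _) hHm]
  have hww : w ⬝ᵥ w = (c - c') ^ 2 + ∑ j, δ j ^ 2 := by
    simp [hw, dotProduct, Fin.sum_univ_succ, sq]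
  have hval : ∀ x i, (H *ᵥ x) i = x i - 2 / ((c - c') ^ 2 + ∑ j, δ j ^ 2) *
      (x 0 * (c - c') - ∑ j : Fin d, x j.succ * δ j) * w i := by
    intro x i
    have hwx : w ⬝ᵥ x = x 0 * (c - c') - ∑ j : Fin d, x j.succ * δ j := by
      simp [hw, dotProduct, Fin.sum_univ_succ, mul_comm, sub_eq_add_neg]
    rw [hHdef, Matrix.sub_mulVec, Matrix.smul_mulVec, Matrix.vecMulVec_mulVec, hwx, hww]
    simp
    ring
  congr 1
  funext x
  refine Prod.ext ?_ (funext fun j => ?_)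
  · change _ = (H *ᵥ x) 0
    rw [hval]
    rfl
  · change _ = (H *ᵥ x) j.succ
    rw [hval]
    change x j.succ + _ = x j.succ - _ * (-δ j)
    rw [mul_neg, sub_neg_eq_add]
    rfl

lemma reflect_add {d : ℕ} {c c' : ℝ} {δ : Fin d → ℝ} (h : c ^ 2 = c' ^ 2 + ∑ j, δ j ^ 2)
    (b : ℝ) (q : ℝ × (Fin d → ℝ)) :
    reflect c c' δ (b * c + q.1, q.2) =
      (b * c' + (reflect c c' δ q).1, b • δ + (reflect c c' δ q).2) := by
  have hk : 2 / ((c - c') ^ 2 + ∑ j, δ j ^ 2) * (c * (c - c')) * (c - c') = c - c' ∧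
      ∀ j, 2 / ((c - c') ^ 2 + ∑ j, δ j ^ 2) * (c * (c - c')) * δ j = δ j := by
    by_cases hs : (c - c') ^ 2 + ∑ j, δ j ^ 2 = 0
    · have h0 : 0 ≤ ∑ j, δ j ^ 2 := Finset.sum_nonneg fun j _ => sq_nonneg _
      have h1 : ∑ j, δ j ^ 2 = 0 := by nlinarith [sq_nonneg (c - c')]
      have h2 : c - c' = 0 := by
        have : (c - c') ^ 2 = 0 := by linarith
        exact pow_eq_zero_iff two_ne_zero |>.1 this
      refine ⟨by simp [h2], fun j => ?_⟩
      have h3 := (Finset.sum_eq_zero_iff_of_nonneg fun j _ => sq_nonneg (δ j)).1 h1 j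
        (Finset.mem_univ j)
      simp [pow_eq_zero_iff two_ne_zero |>.1 h3]
    -- By the equality of norms, the denominator is `2 c (c - c')`.
    · have : 2 / ((c - c') ^ 2 + ∑ j, δ j ^ 2) * (c * (c - c')) = 1 := by
        rw [div_mul_eq_mul_div, div_eq_one_iff_eq hs]
        linarith
      simp [this]
  unfold reflect
  ext j
  · simp only
    linear_combination (-b) * hk.1
  · simp only [Pi.add_apply, Pi.smul_apply, smul_eq_mul]
    linear_combination b * hk.2 j

/-- The reflection is linear, preserves the centered Gaussian and moves the mean `b (c, 0)` to `b
(c', δ)`; it does not depend on `b`. -/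
lemma map_reflect_gaussian_shift {d : ℕ} (v : ℝ≥0) {c c' : ℝ} {δ : Fin d → ℝ}
    (h : c ^ 2 = c' ^ 2 + ∑ j, δ j ^ 2) (b : ℝ) :
    ((gaussianReal (b * c) v).prod (Measure.pi fun _ : Fin d => gaussianReal 0 v)).map
      (reflect c c' δ) =
      ((gaussianReal (b * c') v).prod (Measure.pi fun _ : Fin d => gaussianReal 0 v)).map
        fun q => (q.1, b • δ + q.2) := by
  set γ := Measure.pi fun _ : Fin d => gaussianReal 0 v
  have hshift : ∀ m : ℝ, (gaussianReal m v).prod γ =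
      ((gaussianReal 0 v).prod γ).map fun q => (m + q.1, q.2) := by
    intro m
    have h1 := Measure.map_prod_map (gaussianReal 0 v) γ (f := fun x => m + x) (g := id)
      (by fun_prop) measurable_id
    rw [gaussianReal_map_const_add, zero_add, Measure.map_id] at h1
    rw [h1]
    rfl
  have hr : Measurable (reflect c c' δ) :=
    measurable_reflect measurable_const measurable_const measurable_const measurable_id
  rw [hshift (b * c), hshift (b * c'), Measure.map_map hr (by fun_prop),
    Measure.map_map (by fun_prop) (by fun_prop)]
  conv_rhs => rw [← map_reflect_gaussian d v c c' δ, Measure.map_map (by fun_prop) hr]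
  congr 1
  ext q : 1
  simp [reflect_add h]

/-! ### Continuity of the Gaussian law in its mean. -/

/-- Doubling the variance absorbs a shift of the mean by at most one, by `(x - m)² ≤ 2 (x - m')² + 2
(m' - m)²`; `√2` is the ratio of the normalizing constants. This is the majorant for dominated
convergence. -/
lemma gaussianPDFReal_le {v : ℝ≥0} {m m' : ℝ} (h : |m' - m| ≤ 1) (x : ℝ) :
    gaussianPDFReal m' v x ≤
      √2 * Real.exp (1 / (2 * v)) * gaussianPDFReal m (2 * v) x := by
  unfold gaussianPDFReal
  have h1 : (m' - m) ^ 2 ≤ 1 := by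
    rw [← sq_abs]
    exact pow_le_one₀ (abs_nonneg _) h
  have h2 : -(x - m') ^ 2 / (2 * v) ≤ 1 / (2 * v) + -(x - m) ^ 2 / (2 * (2 * v)) := by
    have h3 : -(x - m) ^ 2 / (2 * (2 * (v : ℝ))) = (-(x - m) ^ 2 / 2) / (2 * v) := by
      rw [div_div]
    rw [h3, ← add_div]
    refine div_le_div_of_nonneg_right ?_ (by positivity)
    nlinarith [sq_nonneg (x - m' - (m' - m))]
  have h4 : √(2 * Real.pi * ((2 * v : ℝ≥0) : ℝ)) = √2 * √(2 * Real.pi * v) := by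
    rw [← Real.sqrt_mul (by norm_num)]
    congr 1
    push_cast
    ring
  have h5 : √2 * Real.exp (1 / (2 * v)) * ((√2 * √(2 * Real.pi * v))⁻¹ *
      Real.exp (-(x - m) ^ 2 / (2 * (2 * v)))) =
      (√(2 * Real.pi * v))⁻¹ * Real.exp (1 / (2 * v) + -(x - m) ^ 2 / (2 * (2 * v))) := by
    rw [Real.exp_add, mul_inv]
    have : √2 ≠ 0 := by positivity
    field_simp
  rw [h4]
  push_cast
  rw [h5]
  gcongr

lemma tendsto_lintegral_gaussianReal {v : ℝ≥0} (hv : v ≠ 0) {ms : ℕ → ℝ} {m : ℝ}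
    (hm : Tendsto ms atTop (𝓝 m)) (h : ℝ → ℝ≥0∞) (c : ℝ≥0) (hh : Measurable h)
    (hc : ∀ x, h x ≤ c) :
    Tendsto (fun k => ∫⁻ x, h x ∂gaussianReal (ms k) v) atTop
      (𝓝 (∫⁻ x, h x ∂gaussianReal m v)) := by
  have hv2 : 2 * v ≠ 0 := mul_ne_zero two_ne_zero hv
  simp only [gaussianReal_of_var_ne_zero _ hv]
  simp only [lintegral_withDensity_eq_lintegral_mul _ (measurable_gaussianPDF _ _) hh]
  set K := √2 * Real.exp (1 / (2 * v))
  refine tendsto_lintegral_filter_of_dominated_convergence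
    (fun x => ENNReal.ofReal K * gaussianPDF m (2 * v) x * c) ?_ ?_ ?_ ?_
  · exact Eventually.of_forall fun k => (measurable_gaussianPDF _ _).mul hh
  · filter_upwards [Metric.tendsto_nhds.1 hm 1 one_pos] with k hk
    refine ae_of_all _ fun x => ?_
    simp only [Pi.mul_apply]
    refine mul_le_mul' ?_ (hc x)
    rw [gaussianPDF, gaussianPDF, ← ENNReal.ofReal_mul (by positivity)]
    exact ENNReal.ofReal_le_ofReal (gaussianPDFReal_le hk.le x)
  · rw [lintegral_mul_const _ ((measurable_gaussianPDF _ _).const_mul _),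
      lintegral_const_mul _ (measurable_gaussianPDF _ _), lintegral_gaussianPDF_eq_one _ hv2]
    simp [ENNReal.mul_eq_top]
  · refine ae_of_all _ fun x => ?_
    simp only [Pi.mul_apply]
    refine ENNReal.Tendsto.mul_const ?_ (Or.inr (ne_top_of_le_ne_top ENNReal.coe_ne_top (hc x)))
    refine (ENNReal.continuous_ofReal.tendsto _).comp ?_
    have hcont : Continuous fun m => gaussianPDFReal m v x := by
      unfold gaussianPDFReal
      fun_prop
    exact (hcont.tendsto m).comp hm

end ContinualRelease

namespace ContinualRelease

/-! ### Simulating an adaptive Gaussian shift by a single Gaussian -/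

/-- The `i`-th row of `U r w` depends only on `r` and the rows of `w` before the `i`-th. -/
def StrictlyCausal {n d : ℕ} {R : Type} (U : R → (Fin n → Fin d → ℝ) → Fin n → Fin d → ℝ) : Prop :=
  ∀ r w w' i, (∀ j < i, w j = w' j) → U r w i = U r w' i

lemma measurable_finCons {Ω E : Type*} [MeasurableSpace Ω] [MeasurableSpace E] {n : ℕ}
    {f : Ω → E} {g : Ω → Fin n → E} (hf : Measurable f) (hg : Measurable g) :
    Measurable fun ω => (Fin.cons (f ω) (g ω) : Fin (n + 1) → E) := by
  refine measurable_pi_lambda _ fun i => ?_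
  refine Fin.cases ?_ (fun i => ?_) i
  · simpa using hf
  · simpa [Function.comp_def] using (measurable_pi_apply i).comp hg

lemma lintegral_pi_finSucc {E : Type*} [MeasurableSpace E] (μ : Measure E) [SigmaFinite μ] {n : ℕ}
    {g : (Fin (n + 1) → E) → ℝ≥0∞} (hg : Measurable g) :
    ∫⁻ G, g G ∂(Measure.pi fun _ : Fin (n + 1) => μ) =
      ∫⁻ x, ∫⁻ G, g (Fin.cons x G) ∂(Measure.pi fun _ : Fin n => μ) ∂μ := by
  have he := (measurePreserving_piFinSuccAbove (fun _ : Fin (n + 1) => μ) 0).symm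
  rw [← he.lintegral_comp hg, lintegral_prod _ (by fun_prop)]
  have h : ∀ x (G : Fin n → E), (MeasurableEquiv.piFinSuccAbove (fun _ : Fin (n + 1) => E) 0).symm
      (x, G) = Fin.cons x G := fun x G => by
    rw [← Fin.insertNth_zero']
    rfl
  simp only [h]

/-- The number `1` or `0` by which a shift is multiplied. -/
def shiftFactor (b : Bool) : ℝ := cond b 1 0

/-- The solutions `W` of `W = U (r, W) + G` with Gaussian noise `G` and two strictly causal `U` at
Euclidean distance at most `m` are functions of one Gaussian variable with mean `m` or `0` and of
noise which has the same law in both cases. -/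
theorem exists_simulation (d : ℕ) (v : ℝ≥0) (n : ℕ) :
    ∀ (R : Type) [MeasurableSpace R]
      (U W : Bool → R → (Fin n → Fin d → ℝ) → Fin n → Fin d → ℝ) (m : R → ℝ),
      (∀ b, Measurable (Function.uncurry (U b))) → (∀ b, StrictlyCausal (U b)) → Measurable m →
      (∀ r w, ∑ i, ∑ j, (U true r w i j - U false r w i j) ^ 2 ≤ m r ^ 2) →
      (∀ b r G, W b r G = U b r (W b r G) + G) → (∀ b, Measurable (Function.uncurry (W b))) →
      ∃ Φ : R × (Fin n → Fin d → ℝ) × ℝ → Fin n → Fin d → ℝ, Measurable Φ ∧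
        ∀ b r (f : (Fin n → Fin d → ℝ) → ℝ≥0∞), Measurable f →
          ∫⁻ Y, ∫⁻ G, f (Φ (r, G, Y))
              ∂(Measure.pi fun _ : Fin n => Measure.pi fun _ : Fin d => gaussianReal 0 v)
              ∂gaussianReal (shiftFactor b * m r) v =
            ∫⁻ G, f (W b r G)
              ∂(Measure.pi fun _ : Fin n => Measure.pi fun _ : Fin d => gaussianReal 0 v) := by
  set γ := Measure.pi fun _ : Fin d => gaussianReal 0 v
  induction n with
  | zero =>
    intro R _ U W m _ _ _ _ _ _
    refine ⟨fun _ => 0, measurable_const, fun b r f _ => ?_⟩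
    simp [fun G => Subsingleton.elim (W b r G) 0]
  | succ n ih =>
    intro R _ U W m hU hcau hm hle hW hWm
    -- By strict causality the first row of `U` depends on `r` alone, so it may be evaluated at `0`.
    set u : Bool → R → Fin d → ℝ := fun b r => U b r 0 0
    have hu0 : ∀ b r w, U b r w 0 = u b r := fun b r w => hcau b r w 0 0 fun j hj => by simp at hj
    have hum : ∀ b, Measurable (u b) := fun b =>
      (measurable_pi_apply 0).comp ((hU b).comp (measurable_id.prodMk measurable_const))
    set δ : R → Fin d → ℝ := fun r => u true r - u false r with hδ
    have hδm : Measurable δ := (hum true).sub (hum false)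
    have hsplit : ∀ r w, ∑ j, δ r j ^ 2 +
        ∑ i : Fin n, ∑ j, (U true r w i.succ j - U false r w i.succ j) ^ 2 ≤ m r ^ 2 := by
      intro r w
      have h := hle r w
      rw [Fin.sum_univ_succ] at h
      simp only [hu0] at h
      exact h
    have hδle : ∀ r, ∑ j, δ r j ^ 2 ≤ m r ^ 2 := fun r =>
      (le_add_of_nonneg_right (Finset.sum_nonneg fun i _ => Finset.sum_nonneg fun j _ =>
        sq_nonneg _)).trans (hsplit r 0)
    -- The distance still available to the later rows.
    set c : R → ℝ := fun r => √(m r ^ 2 - ∑ j, δ r j ^ 2) with hc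
    have hcm : Measurable c := by fun_prop
    have hcsq : ∀ r, m r ^ 2 = c r ^ 2 + ∑ j, δ r j ^ 2 := fun r => by
      rw [hc, Real.sq_sqrt (sub_nonneg.2 (hδle r))]
      ring
    -- For the induction the first row `s.2` of the solution joins the private randomness; the first
    -- noise row is then `s.2 - u b s.1`.
    set W' : Bool → R × (Fin d → ℝ) → (Fin n → Fin d → ℝ) → Fin n → Fin d → ℝ := fun b s G =>
      Fin.tail (W b s.1 (Fin.cons (s.2 - u b s.1) G)) with hW'
    have hcons : ∀ b s G, W b s.1 (Fin.cons (s.2 - u b s.1) G) = Fin.cons s.2 (W' b s G) := by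
      intro b s G
      have h0 : W b s.1 (Fin.cons (s.2 - u b s.1) G) 0 = s.2 := by
        rw [hW, Pi.add_apply, hu0, Fin.cons_zero]
        abel
      rw [hW', ← h0, Fin.cons_self_tail, h0]
    obtain ⟨Φ', hΦ'm, hΦ'⟩ := ih (R × (Fin d → ℝ))
      (fun b s w i => U b s.1 (Fin.cons s.2 w) i.succ) W' (fun s => c s.1)
      (fun b => measurable_pi_lambda _ fun i => (measurable_pi_apply i.succ).comp
        ((hU b).comp (Measurable.prodMk (by fun_prop)
          (measurable_finCons (by fun_prop) (by fun_prop)))))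
      (by
        intro b s w w' i hww
        refine hcau b _ _ _ _ fun j => ?_
        refine Fin.cases (fun _ => by simp) (fun j hj => ?_) j
        simpa using hww j (Fin.succ_lt_succ_iff.1 hj))
      (by fun_prop)
      (fun s w => by
        have h := hsplit s.1 (Fin.cons s.2 w)
        rw [hcsq] at h
        linarith)
      (fun b s G => by
        have h := hW b s.1 (Fin.cons (s.2 - u b s.1) G)
        rw [hcons] at h
        funext i
        have h1 := congrFun h i.succ
        simpa using h1)
      (fun b => by
        have h1 : Measurable fun q : (R × (Fin d → ℝ)) × (Fin n → Fin d → ℝ) =>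
            W b q.1.1 (Fin.cons (q.1.2 - u b q.1.1) q.2) :=
          (hWm b).comp (Measurable.prodMk (by fun_prop)
            (measurable_finCons (measurable_fst.snd.sub ((hum b).comp measurable_fst.fst))
              measurable_snd))
        exact measurable_pi_lambda _ fun i => (measurable_pi_apply i.succ).comp h1)
    set q : R × (Fin (n + 1) → Fin d → ℝ) × ℝ → ℝ × (Fin d → ℝ) := fun t =>
      reflect (m t.1) (c t.1) (δ t.1) (t.2.2, t.2.1 0) with hq
    have hqm : Measurable q :=
      measurable_reflect (by fun_prop) (by fun_prop) (by fun_prop) (by fun_prop)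
    have hum0 := hum false
    have hΦm : Measurable fun t : R × (Fin (n + 1) → Fin d → ℝ) × ℝ =>
        (Fin.cons (u false t.1 + (q t).2)
          (Φ' ((t.1, u false t.1 + (q t).2), Fin.tail t.2.1, (q t).1)) :
            Fin (n + 1) → Fin d → ℝ) := by
      refine measurable_finCons (by fun_prop) (hΦ'm.comp ?_)
      refine Measurable.prodMk (by fun_prop) (Measurable.prodMk ?_ (by fun_prop))
      exact measurable_pi_lambda _ fun i => (measurable_pi_apply i.succ).comp (by fun_prop)
    refine ⟨_, hΦm, fun b r f hf => ?_⟩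
    set F : ℝ × (Fin d → ℝ) → ℝ≥0∞ := fun q => ∫⁻ G, f (Fin.cons (u false r + q.2)
      (Φ' ((r, u false r + q.2), G, q.1))) ∂(Measure.pi fun _ : Fin n => γ) with hF
    have hFm : Measurable F := by
      refine Measurable.lintegral_prod_right' (f := fun z : (ℝ × (Fin d → ℝ)) ×
        (Fin n → Fin d → ℝ) => f (Fin.cons (u false r + z.1.2)
          (Φ' ((r, u false r + z.1.2), z.2, z.1.1)))) ?_
      exact hf.comp (measurable_finCons (by fun_prop) (by fun_prop))
    have hrm : Measurable (reflect (m r) (c r) (δ r)) :=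
      measurable_reflect measurable_const measurable_const measurable_const measurable_id
    calc _ = ∫⁻ Y, ∫⁻ x, F (reflect (m r) (c r) (δ r) (Y, x)) ∂γ
              ∂gaussianReal (shiftFactor b * m r) v := by
          refine lintegral_congr fun Y => ?_
          rw [lintegral_pi_finSucc γ (g := fun G => f (Fin.cons (u false r + (q (r, G, Y)).2)
            (Φ' ((r, u false r + (q (r, G, Y)).2), Fin.tail G, (q (r, G, Y)).1))))
            (hf.comp (hΦm.comp (measurable_const.prodMk (measurable_id.prodMk measurable_const))))]
          simp only [hq, hF, Fin.cons_zero, Fin.tail_cons]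
      _ = ∫⁻ z, F z ∂(((gaussianReal (shiftFactor b * m r) v).prod γ).map
            (reflect (m r) (c r) (δ r))) := by
          rw [lintegral_map hFm hrm, lintegral_prod _ (by fun_prop)]
      _ = ∫⁻ x, ∫⁻ Y, F (Y, shiftFactor b • δ r + x) ∂gaussianReal (shiftFactor b * c r) v ∂γ := by
          rw [map_reflect_gaussian_shift v (hcsq r) (shiftFactor b),
            lintegral_map hFm (by fun_prop), lintegral_prod_symm _ (by fun_prop)]
      _ = ∫⁻ x, ∫⁻ G, f (W b r (Fin.cons x G)) ∂(Measure.pi fun _ : Fin n => γ) ∂γ := by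
          refine lintegral_congr fun x => ?_
          -- Adding `u false` is right in both cases, as the shift `b δ` hidden in `Y` supplies the
          -- difference.
          have hb : u false r + (shiftFactor b • δ r + x) = u b r + x := by
            cases b <;> simp [shiftFactor, hδ, ← add_assoc]
          have h := hΦ' b (r, u b r + x) (fun w => f (Fin.cons (u b r + x) w))
            (hf.comp (measurable_finCons measurable_const measurable_id))
          simp only [hF, hb]
          rw [h]
          refine lintegral_congr fun G => ?_
          have h1 := hcons b (r, u b r + x) G
          simp only [add_sub_cancel_left] at h1
          rw [h1]
      _ = _ := by
          rw [lintegral_pi_finSucc γ]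
          exact hf.comp ((hWm b).comp (measurable_const.prodMk measurable_id))

end ContinualRelease

namespace ContinualRelease

open Matrix Filter Topology

/-! ### Lower triangular matrices and whitening -/

lemma mul_row_congr_of_isLowerTriangular {n d : ℕ} {L : Matrix (Fin n) (Fin n) ℝ}
    (hL : L.IsLowerTriangular) {X X' : Matrix (Fin n) (Fin d) ℝ} {i : Fin n}
    (h : ∀ k ≤ i, X k = X' k) : (L * X) i = (L * X') i := by
  ext j
  simp only [Matrix.mul_apply]
  refine Finset.sum_congr rfl fun k _ => ?_
  rcases le_or_gt k i with hk | hk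
  · rw [h k hk]
  · rw [hL (by simpa using hk)]
    simp

/-- Whitening by a lower triangular matrix. -/
lemma exists_isLowerTriangular_whitening {n p : ℕ} (B : Matrix (Fin n) (Fin p) ℝ)
    (hB : Function.Injective fun x => x ᵥ* B) :
    ∃ T : Matrix (Fin n) (Fin n) ℝ, T.IsLowerTriangular ∧ IsUnit T ∧ (T * B) * (T * B)ᵀ = 1 := by
  have hS : (B * Bᴴ).PosDef := Matrix.PosDef.mul_conjTranspose_self B hB
  -- The LDL decomposition diagonalizes `B * Bᴴ` by a lower triangular matrix; scaling its rows by
  -- the inverse roots of the diagonal entries gives `T`.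
  set T₀ := LDL.lowerInv hS with hT₀
  have hT₀unit : IsUnit T₀ := isUnit_of_invertible T₀
  have hdiag := LDL.diag_eq_lowerInv_conj hS
  have hpos : (LDL.diag hS).PosDef := by
    rw [hdiag]
    exact hS.mul_mul_conjTranspose_same (Matrix.vecMul_injective_of_isUnit hT₀unit)
  set e := LDL.diagEntries hS
  have he : ∀ i, 0 < e i := Matrix.posDef_diagonal_iff.1 hpos
  have hsq : Matrix.diagonal (fun i => (√(e i))⁻¹) * Matrix.diagonal e *
      Matrix.diagonal (fun i => (√(e i))⁻¹) = 1 := by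
    rw [Matrix.diagonal_mul_diagonal, Matrix.diagonal_mul_diagonal, ← Matrix.diagonal_one]
    congr 1
    funext i
    have h1 : √(e i) ≠ 0 := (Real.sqrt_pos.2 (he i)).ne'
    have h2 : e i = √(e i) * √(e i) := (Real.mul_self_sqrt (he i).le).symm
    nth_rw 2 [h2]
    field_simp
  have hconj : Matrix.diagonal e = T₀ * B * Bᵀ * T₀ᵀ := by
    have : Matrix.diagonal e = T₀ * (B * Bᴴ) * T₀ᴴ := hdiag
    simpa [Matrix.conjTranspose_eq_transpose_of_trivial, Matrix.mul_assoc] using this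
  have hTT : (Matrix.diagonal (fun i => (√(e i))⁻¹) * T₀ * B) *
      (Matrix.diagonal (fun i => (√(e i))⁻¹) * T₀ * B)ᵀ = 1 := by
    rw [← hsq, hconj]
    simp only [Matrix.transpose_mul, Matrix.diagonal_transpose, Matrix.mul_assoc]
  refine ⟨Matrix.diagonal (fun i => (√(e i))⁻¹) * T₀, ?_, ?_, hTT⟩
  · refine Matrix.BlockTriangular.mul (Matrix.blockTriangular_diagonal _) fun i j hij => ?_
    exact LDL.lowerInv_triangular hS (by simpa using hij)
  · refine IsUnit.of_mul_eq_one _ (?_ : _ * (B * (Matrix.diagonal (fun i => (√(e i))⁻¹) * T₀ * B)ᵀ) = 1)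
    rw [← Matrix.mul_assoc, hTT]

lemma frobeniusNorm_sq {m d : ℕ} (X : Matrix (Fin m) (Fin d) ℝ) :
    frobeniusNorm X ^ 2 = ∑ i, ∑ j, X i j ^ 2 := by
  have h0 : 0 ≤ ∑ i, ∑ j, X i j ^ 2 :=
    Finset.sum_nonneg fun i _ => Finset.sum_nonneg fun j _ => sq_nonneg _
  rw [frobeniusNorm, Matrix.frobenius_norm_def]
  simp only [Real.norm_eq_abs, Real.rpow_ofNat, sq_abs]
  rw [← Real.sqrt_eq_rpow, Real.sq_sqrt h0]

open scoped Matrix.Norms.Frobenius in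
lemma frobeniusNorm_mul_le {l m d : ℕ} (X : Matrix (Fin l) (Fin m) ℝ)
    (Y : Matrix (Fin m) (Fin d) ℝ) :
    frobeniusNorm (X * Y) ≤ frobeniusNorm X * frobeniusNorm Y :=
  Matrix.frobenius_norm_mul X Y

open scoped Matrix.Norms.Frobenius in
lemma frobeniusNorm_nonneg {m d : ℕ} (X : Matrix (Fin m) (Fin d) ℝ) : 0 ≤ frobeniusNorm X :=
  norm_nonneg X

open scoped Matrix.Norms.Frobenius in
lemma frobeniusNorm_neg {m d : ℕ} (X : Matrix (Fin m) (Fin d) ℝ) :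
    frobeniusNorm (-X) = frobeniusNorm X :=
  norm_neg X

/-! ### Transcripts -/

lemma matrixMechanism_eq {n p d : ℕ} (B : Matrix (Fin n) (Fin p) ℝ) (C : Matrix (Fin p) (Fin n) ℝ)
    (Z : Matrix (Fin p) (Fin d) ℝ) (x : DataStream n d) :
    matrixMechanism B C Z x = B * C * x + B * Z := by
  rw [matrixMechanism, Matrix.mul_add, Matrix.mul_assoc]

lemma transcript_congr {n d : ℕ} {R W : Type} [MeasurableSpace R]
    {M : W → DataStream n d → DataStream n d} {s s' : Strategy n d R} {r : R} {z z' : W}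
    (hM : M z = M z') (hs : ∀ y, s.stream r y = s'.stream r y) (k : ℕ) :
    transcript M s r z k = transcript M s' r z' k := by
  induction k with
  | zero => rfl
  | succ k ih => simp only [transcript, ih, hM, hs]

lemma transcript_succ_of_eq {n d : ℕ} {R W : Type} [MeasurableSpace R]
    (M : W → DataStream n d → DataStream n d) (s : Strategy n d R) (r : R) (z : W) {k : ℕ}
    {i : Fin n} (hi : (i : ℕ) = k) :
    transcript M s r z (k + 1) i = M z (Matrix.of fun j =>
      if (j : ℕ) ≤ k then s.stream r (transcript M s r z k) j else 0) i :=
  if_pos hi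

lemma transcript_succ_of_ne {n d : ℕ} {R W : Type} [MeasurableSpace R]
    (M : W → DataStream n d → DataStream n d) (s : Strategy n d R) (r : R) (z : W) {k : ℕ}
    {i : Fin n} (hi : (i : ℕ) ≠ k) :
    transcript M s r z (k + 1) i = transcript M s r z k i :=
  if_neg hi

lemma transcript_row_eq {n d : ℕ} {R W : Type} [MeasurableSpace R]
    (M : W → DataStream n d → DataStream n d) (s : Strategy n d R) (r : R) (z : W) {k : ℕ}
    {i : Fin n} (hi : (i : ℕ) < k) :
    transcript M s r z k i = transcript M s r z (i + 1) i := by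
  induction k with
  | zero => omega
  | succ k ih =>
    by_cases h : (i : ℕ) = k
    · rw [h]
    · rw [← ih (by omega), transcript_succ_of_ne M s r z h]

lemma stream_row_congr {n d : ℕ} {R : Type} [MeasurableSpace R] (s : Strategy n d R) (r : R)
    {y y' : DataStream n d} {i : Fin n} (h : ∀ j < i, y j = y' j) :
    s.stream r y i = s.stream r y' i := by
  have : (fun j : {j : Fin n // j < i} => y j) = fun j : {j : Fin n // j < i} => y' j :=
    funext fun j => h j j.2
  change s.row i r (fun j => y j) = s.row i r (fun j => y' j)
  rw [this]

/-- The released rows solve the equation of the mechanism for the input rows that the rule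
chooses in response to them. -/
lemma transcript_eq {n p d : ℕ} {B : Matrix (Fin n) (Fin p) ℝ} {C : Matrix (Fin p) (Fin n) ℝ}
    (hA : (B * C).IsLowerTriangular) {R : Type} [MeasurableSpace R] (s : Strategy n d R) (r : R)
    (Z : Matrix (Fin p) (Fin d) ℝ) :
    transcript (matrixMechanism B C) s r Z n =
      B * C * s.stream r (transcript (matrixMechanism B C) s r Z n) + B * Z := by
  funext i
  rw [transcript_row_eq _ s r Z i.2, transcript_succ_of_eq _ s r Z rfl, matrixMechanism_eq]
  -- Row `i` of the output ignores input rows after `i`, so the zeros standing in for rows not yet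
  -- chosen are harmless.
  refine congrArg (· + (B * Z) i) (mul_row_congr_of_isLowerTriangular hA fun k hk => ?_)
  refine (if_pos (by exact_mod_cast hk)).trans ?_
  refine stream_row_congr s r fun j hj => ?_
  rw [transcript_row_eq _ s r Z j.2, transcript_row_eq _ s r Z (lt_of_lt_of_le hj hk)]

lemma measurable_row {m d : ℕ} (i : Fin m) :
    Measurable fun X : Matrix (Fin m) (Fin d) ℝ => X i :=
  measurable_pi_apply (X := fun _ : Fin m => Fin d → ℝ) i

lemma measurable_stream {n d : ℕ} {R Ω : Type} [MeasurableSpace R] [MeasurableSpace Ω]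
    (s : Strategy n d R) {f : Ω → R} {y : Ω → DataStream n d} (hf : Measurable f)
    (hy : Measurable y) : Measurable fun ω => s.stream (f ω) (y ω) :=
  measurable_pi_lambda _ fun i => (s.measurable_row i).comp
    (hf.prodMk (measurable_pi_lambda _ fun j => (measurable_row j.1).comp hy))

lemma measurable_transcript {n p d : ℕ} (B : Matrix (Fin n) (Fin p) ℝ)
    (C : Matrix (Fin p) (Fin n) ℝ) {R : Type} [MeasurableSpace R] (s : Strategy n d R) (k : ℕ) :
    Measurable fun q : R × Matrix (Fin p) (Fin d) ℝ =>
      transcript (matrixMechanism B C) s q.1 q.2 k := by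
  induction k with
  | zero => exact measurable_const
  | succ k ih =>
    refine measurable_pi_lambda _ fun i => ?_
    by_cases hi : (i : ℕ) = k
    · simp only [transcript_succ_of_eq _ s _ _ hi, matrixMechanism_eq]
      refine (measurable_row i).comp (measurable_add_matrix
        ((measurable_const_mul_matrix _).comp ?_)
        ((measurable_const_mul_matrix _).comp measurable_snd))
      refine measurable_pi_lambda _ fun j => ?_
      by_cases hj : (j : ℕ) ≤ k
      · convert (measurable_row j).comp (measurable_stream s measurable_fst ih) using 2
        exact if_pos hj
      · convert measurable_const (a := (0 : Fin d → ℝ)) using 2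
        exact if_neg hj
    · simp only [transcript_succ_of_ne _ s _ _ hi]
      exact (measurable_row i).comp ih

/-! ### From nonadaptive to adaptive privacy -/

lemma measurable_matrixMechanism {n p d : ℕ} (B : Matrix (Fin n) (Fin p) ℝ)
    (C : Matrix (Fin p) (Fin n) ℝ) (x : DataStream n d) :
    Measurable fun Z : Matrix (Fin p) (Fin d) ℝ => matrixMechanism B C Z x := by
  simp only [matrixMechanism_eq]
  exact measurable_add_matrix measurable_const (measurable_const_mul_matrix _)

/-- Projecting the whitened output to the line through the two whitened inputs. -/
lemma priv_gaussianReal_of_priv_mechanism {priv : PrivacyNotion} (hp : priv.IsStable) {n p d : ℕ}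
    {B : Matrix (Fin n) (Fin p) ℝ} {C : Matrix (Fin p) (Fin n) ℝ} {T : Matrix (Fin n) (Fin n) ℝ}
    (hT : (T * B) * (T * B)ᵀ = 1) {v : ℝ≥0} {x x' : DataStream n d}
    (h : priv (DataStream n d) ((gaussianMatrix p d v).map fun Z => matrixMechanism B C Z x)
      ((gaussianMatrix p d v).map fun Z => matrixMechanism B C Z x')) :
    priv ℝ (gaussianReal 0 v) (gaussianReal (frobeniusNorm (T * (B * C) * (x' - x))) v) := by
  set D := T * (B * C) * (x' - x) with hD
  set m := frobeniusNorm D with hm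
  by_cases hm0 : m = 0
  · rw [hm0]
    exact hp.refl _
  -- The unit vector along `D`: pairing with it turns the shift `D` into `m` and the whitened noise
  -- into `N(0, v)`.
  set θ : Matrix (Fin n) (Fin d) ℝ := m⁻¹ • D with hθ
  have hθ1 : ∑ i, ∑ j, θ i j ^ 2 = 1 := by
    simp only [hθ, Matrix.smul_apply, smul_eq_mul, mul_pow, ← Finset.mul_sum]
    rw [← frobeniusNorm_sq, ← hm]
    field_simp
  have hθD : ∑ i, ∑ j, θ i j * D i j = m := by
    simp only [hθ, Matrix.smul_apply, smul_eq_mul, mul_assoc, ← Finset.mul_sum, ← sq]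
    rw [← frobeniusNorm_sq, ← hm]
    field_simp
  have hlm : Measurable fun G : Matrix (Fin n) (Fin d) ℝ => ∑ i, ∑ j, θ i j * G i j :=
    Finset.measurable_fun_sum _ fun i _ => Finset.measurable_fun_sum _ fun j _ =>
      (measurable_entry i j).const_mul _
  set g : DataStream n d → ℝ := fun y =>
    ∑ i, ∑ j, θ i j * (T * y + -(T * (B * C) * x)) i j with hg
  have hgm : Measurable g :=
    hlm.comp (measurable_add_matrix (measurable_const_mul_matrix T) measurable_const)
  have hnoise : (gaussianMatrix p d v).map (fun Z => ∑ i, ∑ j, θ i j * (T * B * Z) i j) =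
      gaussianReal 0 v := by
    rw [← map_sum_mul_gaussianMatrix v θ hθ1, ← map_mul_gaussianMatrix d v (T * B) hT,
      Measure.map_map hlm (measurable_const_mul_matrix _)]
    rfl
  have hnm : Measurable fun Z : Matrix (Fin p) (Fin d) ℝ => ∑ i, ∑ j, θ i j * (T * B * Z) i j :=
    hlm.comp (measurable_const_mul_matrix (T * B))
  have key : ∀ (w : DataStream n d) (a : ℝ), ∑ i, ∑ j, θ i j * (T * (B * C) * (w - x)) i j = a →
      ((gaussianMatrix p d v).map fun Z => matrixMechanism B C Z w).map g = gaussianReal a v := by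
    intro w a ha
    rw [Measure.map_map hgm (measurable_matrixMechanism B C w)]
    have h1 : (g ∘ fun Z => matrixMechanism B C Z w) =
        (fun t => a + t) ∘ fun Z : Matrix (Fin p) (Fin d) ℝ =>
          ∑ i, ∑ j, θ i j * (T * B * Z) i j := by
      funext Z
      have h2 : T * matrixMechanism B C Z w + -(T * (B * C) * x) =
          T * (B * C) * (w - x) + T * B * Z := by
        rw [matrixMechanism_eq, Matrix.mul_add, Matrix.mul_sub, ← Matrix.mul_assoc T B Z,
          ← Matrix.mul_assoc T (B * C) w]
        abel
      simp only [hg, Function.comp_apply]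
      rw [h2]
      simp only [Matrix.add_apply, mul_add, Finset.sum_add_distrib, ha]
    rw [h1, ← Measure.map_map (by fun_prop) hnm, hnoise, gaussianReal_map_const_add, zero_add]
  have := Measure.isProbabilityMeasure_map (μ := gaussianMatrix p d v)
    (measurable_matrixMechanism B C x).aemeasurable
  have := Measure.isProbabilityMeasure_map (μ := gaussianMatrix p d v)
    (measurable_matrixMechanism B C x').aemeasurable
  have h3 := hp.map hgm h
  rwa [key x 0 (by simp), key x' m hθD] at h3

/-- The adversary's view is obtained from one Gaussian variable by randomized postprocessing. -/
lemma priv_viewLaw_of_priv_gaussianReal {priv : PrivacyNotion} (hp : priv.IsStable) {n p d : ℕ}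
    {B : Matrix (Fin n) (Fin p) ℝ} {C : Matrix (Fin p) (Fin n) ℝ} {T : Matrix (Fin n) (Fin n) ℝ}
    (hA : (B * C).IsLowerTriangular) (hTl : T.IsLowerTriangular) (hTu : IsUnit T)
    (hT : (T * B) * (T * B)ᵀ = 1) {v : ℝ≥0} {m : ℝ}
    (h : priv ℝ (gaussianReal 0 v) (gaussianReal m v)) {R : Type} [MeasurableSpace R]
    (seed : Measure R) [IsProbabilityMeasure seed] (s s' : Strategy n d R)
    (hs : ∀ r y, frobeniusNorm (T * (B * C) * (s'.stream r y - s.stream r y)) ≤ m) :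
    priv (R × DataStream n d) (viewLaw seed (gaussianMatrix p d v) (matrixMechanism B C) s)
      (viewLaw seed (gaussianMatrix p d v) (matrixMechanism B C) s') := by
  have hTdet : IsUnit T.det := (Matrix.isUnit_iff_isUnit_det T).1 hTu
  set Q := T * B with hQ
  set S : Bool → Strategy n d R := fun b => cond b s' s with hS
  set U : Bool → R → Matrix (Fin n) (Fin d) ℝ → Matrix (Fin n) (Fin d) ℝ := fun b r w =>
    T * (B * C) * (S b).stream r (T⁻¹ * w) with hU
  -- The noise `Z` is replaced by `Qᵀ * G`, where `G` stands for `Q * Z`. Only `B * Z` matters, and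
  -- `B * Qᵀ * Q = B` because `Q * Qᵀ = 1` and `T` is invertible.
  set W : Bool → R → Matrix (Fin n) (Fin d) ℝ → Matrix (Fin n) (Fin d) ℝ := fun b r G =>
    T * transcript (matrixMechanism B C) (S b) r (Qᵀ * G) n with hW
  have hTinv : (T⁻¹).IsLowerTriangular := by
    have := hTu.invertible
    exact Matrix.blockTriangular_inv_of_blockTriangular hTl
  have hcau : ∀ b, StrictlyCausal (U b) := by
    intro b r w w' i hww
    refine mul_row_congr_of_isLowerTriangular (hTl.mul hA) fun k hk => ?_
    refine stream_row_congr _ r fun j hj => ?_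
    exact mul_row_congr_of_isLowerTriangular hTinv fun l hl =>
      hww l (lt_of_le_of_lt hl (lt_of_lt_of_le hj hk))
  have hUm : ∀ b, Measurable (Function.uncurry (U b)) := fun b =>
    (measurable_const_mul_matrix _).comp (measurable_stream (S b) measurable_fst
      ((measurable_const_mul_matrix _).comp measurable_snd))
  have hWm : ∀ b, Measurable (Function.uncurry (W b)) := fun b =>
    (measurable_const_mul_matrix T).comp ((measurable_transcript B C (S b) n).comp
      (measurable_fst.prodMk ((measurable_const_mul_matrix Qᵀ).comp measurable_snd)))
  have hWeq : ∀ b r G, W b r G = U b r (W b r G) + G := by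
    intro b r G
    have h1 := transcript_eq hA (S b) r (Qᵀ * G)
    simp only [hW, hU, Matrix.nonsing_inv_mul_cancel_left _ _ hTdet]
    conv_lhs => rw [h1]
    rw [Matrix.mul_add, ← Matrix.mul_assoc T (B * C), ← Matrix.mul_assoc T B (_ * _),
      ← Matrix.mul_assoc (T * B) _ G,
      ← hQ, hT, Matrix.one_mul]
  have hle : ∀ r w, ∑ i, ∑ j, (U true r w i j - U false r w i j) ^ 2 ≤ m ^ 2 := by
    intro r w
    have h1 : T * (B * C) * (s'.stream r (T⁻¹ * w) - s.stream r (T⁻¹ * w)) =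
        U true r w - U false r w := by
      simp only [hU, hS, Matrix.mul_sub, cond_true, cond_false]
    have h2 := pow_le_pow_left₀ (frobeniusNorm_nonneg _) (hs r (T⁻¹ * w)) 2
    rw [h1, frobeniusNorm_sq] at h2
    exact h2
  obtain ⟨Φ, hΦm, hΦ⟩ := exists_simulation d v n R U W (fun _ => m) hUm hcau measurable_const
    hle hWeq hWm
  set ψ : (ℝ × Matrix (Fin n) (Fin d) ℝ) × R → R × DataStream n d := fun t =>
    (t.2, T⁻¹ * Matrix.of (Φ (t.2, t.1.2, t.1.1))) with hψ
  have hψm : Measurable ψ := measurable_snd.prodMk ((measurable_const_mul_matrix T⁻¹).comp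
    (hΦm.comp (measurable_snd.prodMk (measurable_fst.snd.prodMk measurable_fst.fst))))
  have key : ∀ b, ((((gaussianReal (shiftFactor b * m) v).prod (gaussianMatrix n d v)).prod
      seed).map ψ) = viewLaw seed (gaussianMatrix p d v) (matrixMechanism B C) (S b) := by
    intro b
    have hpost : Measurable fun q : R × Matrix (Fin n) (Fin d) ℝ =>
        ((q.1, T⁻¹ * W b q.1 q.2) : R × DataStream n d) :=
      measurable_fst.prodMk ((measurable_const_mul_matrix T⁻¹).comp (hWm b))
    have hview : viewLaw seed (gaussianMatrix p d v) (matrixMechanism B C) (S b) =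
        (seed.prod (gaussianMatrix n d v)).map fun q => (q.1, T⁻¹ * W b q.1 q.2) := by
      have h1 := Measure.map_prod_map seed (gaussianMatrix p d v) measurable_id
        (measurable_const_mul_matrix (d := d) Q)
      rw [Measure.map_id, map_mul_gaussianMatrix d v Q hT] at h1
      rw [h1, Measure.map_map hpost
        (measurable_id.prodMap (measurable_const_mul_matrix Q)), viewLaw]
      congr 1
      funext q
      refine Prod.ext rfl ?_
      change _ = T⁻¹ * W b q.1 (Q * q.2)
      simp only [hW, Matrix.nonsing_inv_mul_cancel_left _ _ hTdet]
      refine transcript_congr ?_ (fun _ => rfl) n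
      funext x
      rw [matrixMechanism_eq, matrixMechanism_eq]
      congr 1
      have h2 : T * (B * Qᵀ * Q) = T * B := by
        rw [← Matrix.mul_assoc T (B * Qᵀ), ← Matrix.mul_assoc T B, ← hQ, hT, Matrix.one_mul]
      have h3 := congrArg (T⁻¹ * ·) h2
      simp only [Matrix.nonsing_inv_mul_cancel_left _ _ hTdet] at h3
      rw [← Matrix.mul_assoc Qᵀ, ← Matrix.mul_assoc B, ← Matrix.mul_assoc B, h3]
    refine Measure.ext_of_lintegral _ fun f hf => ?_
    rw [hview, lintegral_map hf hψm, lintegral_map hf hpost,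
      lintegral_prod_symm (fun t => f (ψ t)) (hf.comp hψm).aemeasurable,
      lintegral_prod (fun q => f (q.1, T⁻¹ * W b q.1 q.2)) (hf.comp hpost).aemeasurable]
    refine lintegral_congr fun r => ?_
    have hfr : Measurable fun w : Matrix (Fin n) (Fin d) ℝ =>
        f (r, (T⁻¹ * w : Matrix (Fin n) (Fin d) ℝ)) :=
      hf.comp (measurable_const.prodMk (measurable_const_mul_matrix T⁻¹))
    rw [lintegral_prod (fun a => f (ψ (a, r))) ((hf.comp hψm).comp measurable_prodMk_right).aemeasurable]
    exact hΦ b r _ hfr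
  have h4 := hp.map hψm (hp.prod seed (hp.prod (gaussianMatrix n d v) h))
  have k0 := key false
  have k1 := key true
  simp only [shiftFactor, cond_false, cond_true, zero_mul, one_mul] at k0 k1
  rwa [k0, k1] at h4

/-- The adversary may pick different neighbors for different outputs, so the simulation needs one
shift for all of `N`: the supremum of the whitened distances. The bound `κ` serves to make it
finite. -/
theorem adaptivelyPrivate_of_nonadaptivelyPrivate {priv : PrivacyNotion} (hp : priv.IsStable)
    {n p d : ℕ} {B : Matrix (Fin n) (Fin p) ℝ} {C : Matrix (Fin p) (Fin n) ℝ}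
    (hA : (B * C).IsLowerTriangular) (hunit : IsUnit (B * C))
    {N : Set (DataStream n d × DataStream n d)} {κ : ℝ}
    (hκ : ∀ x x' : DataStream n d, (x, x') ∈ N → frobeniusNorm (C * (x - x')) ≤ κ) (v : ℝ≥0)
    (h : NonadaptivelyPrivate priv N (gaussianMatrix p d v) (matrixMechanism B C)) :
    AdaptivelyPrivate priv N (gaussianMatrix p d v) (matrixMechanism B C) := by
  intro R _ seed _ s s' hss
  by_cases hv : v = 0
  · subst hv
    -- Without noise, distinct neighbors yield distinct point masses as `B * C` is invertible, so
    -- the notion is trivial. If neighbors are always equal, the two views coincide.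
    by_cases hN : ∃ x x', (x, x') ∈ N ∧ x ≠ x'
    · obtain ⟨x, x', hx, hne⟩ := hN
      have h1 := h x x' hx
      have hdirac : ∀ w : DataStream n d, (gaussianMatrix p d 0).map
          (fun Z => matrixMechanism B C Z w) = Measure.dirac (B * C * w) := by
        intro w
        rw [gaussianMatrix_zero_var, Measure.map_dirac' (measurable_matrixMechanism B C w),
          matrixMechanism_eq, Matrix.mul_zero, add_zero]
      rw [hdirac, hdirac] at h1
      have := hunit.invertible
      have hne' : B * C * x' ≠ B * C * x := fun heq => hne
        ((Matrix.mul_right_inj_of_invertible _).1 heq).symm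
      have hmeas : MeasurableSet ({B * C * x} : Set (DataStream n d)) :=
        measurableSet_singleton (α := Fin n → Fin d → ℝ) _
      have hprob : ∀ t : Strategy n d R, IsProbabilityMeasure
          (viewLaw seed (gaussianMatrix p d 0) (matrixMechanism B C) t) := fun t =>
        Measure.isProbabilityMeasure_map
          (measurable_fst.prodMk (measurable_transcript B C t n)).aemeasurable
      have := hprob s
      have := hprob s'
      exact hp.of_dirac hmeas (Set.mem_singleton _) hne' h1 _ _
    · push Not at hN
      have heq : viewLaw seed (gaussianMatrix p d 0) (matrixMechanism B C) s' =
          viewLaw seed (gaussianMatrix p d 0) (matrixMechanism B C) s := by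
        unfold viewLaw
        congr 1
        funext q
        rw [transcript_congr rfl (fun y => (hN _ _ (hss q.1 y)).symm)]
      have : IsProbabilityMeasure (viewLaw seed (gaussianMatrix p d 0) (matrixMechanism B C) s) :=
        Measure.isProbabilityMeasure_map
          (measurable_fst.prodMk (measurable_transcript B C s n)).aemeasurable
      rw [heq]
      exact hp.refl _
  · have hBinj : Function.Injective fun x => x ᵥ* B := by
      intro a b hab
      have h1 : a ᵥ* (B * C) = b ᵥ* (B * C) := by
        rw [← Matrix.vecMul_vecMul, ← Matrix.vecMul_vecMul]
        exact congrArg (· ᵥ* C) hab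
      exact Matrix.vecMul_injective_of_isUnit hunit h1
    obtain ⟨T, hTl, hTu, hT⟩ := exists_isLowerTriangular_whitening B hBinj
    set L : Set ℝ := (fun q : DataStream n d × DataStream n d =>
      frobeniusNorm (T * (B * C) * (q.2 - q.1))) '' N with hL
    obtain ⟨r₀⟩ := seed.nonempty_of_neZero
    have hLne : L.Nonempty := ⟨_, _, hss r₀ 0, rfl⟩
    have hLbdd : BddAbove L := by
      refine ⟨frobeniusNorm (T * B) * κ, ?_⟩
      rintro _ ⟨⟨x, x'⟩, hx, rfl⟩
      have h1 : T * (B * C) * (x' - x) = T * B * -(C * (x - x')) := by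
        rw [← Matrix.mul_neg, neg_sub, Matrix.mul_assoc, Matrix.mul_assoc, Matrix.mul_assoc]
      simp only [h1]
      refine (frobeniusNorm_mul_le _ _).trans ?_
      rw [frobeniusNorm_neg]
      exact mul_le_mul_of_nonneg_left (hκ x x' hx) (frobeniusNorm_nonneg _)
    -- The supremum need not be attained, hence the passage to the limit.
    obtain ⟨ms, -, hms, hmsL⟩ := exists_seq_tendsto_sSup hLne hLbdd
    have hsup : priv ℝ (gaussianReal 0 v) (gaussianReal (sSup L) v) := by
      refine hp.of_tendsto (Qs := fun k => gaussianReal (ms k) v)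
        (tendsto_lintegral_gaussianReal hv hms) fun k => ?_
      obtain ⟨⟨x, x'⟩, hx, hxk⟩ := hmsL k
      rw [← hxk]
      exact priv_gaussianReal_of_priv_mechanism hp hT (h x x' hx)
    exact priv_viewLaw_of_priv_gaussianReal hp hA hTl hTu hT hsup seed s s' fun r y =>
      le_csSup hLbdd ⟨_, hss r y, rfl⟩

end ContinualRelease

theorem mainTheorem6 {n p d : ℕ} (A : Matrix (Fin n) (Fin n) ℝ)
    (B : Matrix (Fin n) (Fin p) ℝ) (C : Matrix (Fin p) (Fin n) ℝ)
    (hA : A.IsLowerTriangular) (hrank : A.rank = n) (hBC : A = B * C)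
    (N : Set (DataStream n d × DataStream n d)) (κ σ : ℝ)
    (hκ : ∀ x x' : DataStream n d, (x, x') ∈ N → frobeniusNorm (C * (x - x')) ≤ κ) :
    (∀ ε δ : ℝ≥0,
      NonadaptivelyPrivate (approxDP ε δ) N
        (gaussianMatrix p d (Real.toNNReal (κ ^ 2 * σ ^ 2))) (matrixMechanism B C) →
      AdaptivelyPrivate (approxDP ε δ) N
        (gaussianMatrix p d (Real.toNNReal (κ ^ 2 * σ ^ 2))) (matrixMechanism B C)) ∧
    (∀ ρ : ℝ≥0,
      NonadaptivelyPrivate (zCDP ρ) N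
        (gaussianMatrix p d (Real.toNNReal (κ ^ 2 * σ ^ 2))) (matrixMechanism B C) →
      AdaptivelyPrivate (zCDP ρ) N
        (gaussianMatrix p d (Real.toNNReal (κ ^ 2 * σ ^ 2))) (matrixMechanism B C)) ∧
    (∀ μ : ℝ≥0,
      NonadaptivelyPrivate (gaussianDP μ) N
        (gaussianMatrix p d (Real.toNNReal (κ ^ 2 * σ ^ 2))) (matrixMechanism B C) →
      AdaptivelyPrivate (gaussianDP μ) N
        (gaussianMatrix p d (Real.toNNReal (κ ^ 2 * σ ^ 2))) (matrixMechanism B C)) := by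
  subst hBC
  have hunit : IsUnit (B * C) := by
    rw [← Matrix.linearIndependent_rows_iff_isUnit, linearIndependent_iff_card_eq_finrank_span,
      Set.finrank, ← Matrix.rank_eq_finrank_span_row, hrank, Fintype.card_fin]
  exact ⟨fun ε δ => adaptivelyPrivate_of_nonadaptivelyPrivate (approxDP_isStable ε δ) hA hunit hκ _,
    fun ρ => adaptivelyPrivate_of_nonadaptivelyPrivate (zCDP_isStable ρ) hA hunit hκ _,
    fun μ => adaptivelyPrivate_of_nonadaptivelyPrivate (gaussianDP_isStable μ) hA hunit hκ _⟩
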